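/- A \emph{fullerene} is a simple convex $3$-polytope all of whose facets are pentagons and hexagons. The \emph{faces} of a polytope are the intersections of its facets (the polytope itself included), and two polytopes are \emph{combinatorially equivalent} if there is a bijection between their sets of faces that preserves inclusion in both directions. For $k\ge 0$ the combinatorial polytope $D_k$ is obtained from the dodecahedron by cutting its surface along a zigzag cycle into two caps, each a pentagon surrounded by five pentagons, and inserting between the caps $k$ successive cyclic belts of five hexagons, each hexagon meeting its two neighbours in its belt along opposite edges. Explicitly, its facets are $T$, $B$ and $R_{j,i}$ with $0\le j\le k+1$, $i\in\mathbb Z/5$; its $20+10k$ vertices are given by the triples of facets that meet in them, $$\{T,R_{0,i},R_{0,i+1}\},\quad \{R_{j,i},R_{j,i+1},R_{j+1,i}\},\quad \{R_{j,i+1},R_{j+1,i},R_{j+1,i+1}\}\ (0\le j\le k),\quad \{R_{k+1,i},R_{k+1,i+1},B\},$$ where $i\in\mathbb Z/5$; and its faces are the intersections of facets, each regarded as a set of vertices. In particular, $D_0$ is the dodecahedron. \textbf{Theorem.} A fullerene $P$ is combinatorially equivalent to $D_k$ for some $k\ge 0$ if and only if it contains the cap, that is, if and only if $P$ has a pentagonal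 facet $F$ and five pairwise different pentagonal facets $F_0,\dots,F_4$, all different from $F$, such that $F\cap F_i$ and $F_i\cap F_{i+1}$ are edges for all $i\in\mathbb Z/5$. -/

import Mathlib

/-- A convex `n`-polytope in `ℝⁿ`: a bounded set with nonempty interior, given by an irredundant
finite system of inequalities `⟪a i, x⟫ + b i ≥ 0`. -/
structure ConvexPolytope (n : ℕ) where
  /-- the number of inequalities, that is, of facets -/
  m : ℕ
  a : Fin m → EuclideanSpace ℝ (Fin n)
  b : Fin m → ℝ
  bounded : Bornology.IsBounded {x | ∀ i, 0 ≤ inner ℝ (a i) x + b i}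
  irredundant : ∀ i, {x | ∀ j, j ≠ i → 0 ≤ inner ℝ (a j) x + b j} ≠
    {x | ∀ j, 0 ≤ inner ℝ (a j) x + b j}
  fullDim : (interior {x | ∀ i, 0 ≤ inner ℝ (a i) x + b i}).Nonempty

/-- All the intersections of members of the family `F` of subsets of `B`;
the empty intersection is `B`. -/
def facesOf {X ι : Type*} (B : Set X) (F : ι → Set X) : Set (Set X) :=
  {G | ∃ S : Set ι, G = B ∩ ⋂ i ∈ S, F i}

/-- Combinatorial equivalence of two sets of faces: a bijection that preserves inclusion in both
directions. -/
def CombEquiv {X Y : Type*} (A : Set (Set X)) (B : Set (Set Y)) : Prop :=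
  Nonempty (A ≃o B)

namespace ConvexPolytope

variable {n : ℕ}

/-- The underlying set of points. -/
def carrier (P : ConvexPolytope n) : Set (EuclideanSpace ℝ (Fin n)) :=
  {x | ∀ i, 0 ≤ inner ℝ (P.a i) x + P.b i}

/-- The `i`-th facet. -/
def facet (P : ConvexPolytope n) (i : Fin P.m) : Set (EuclideanSpace ℝ (Fin n)) :=
  P.carrier ∩ {x | inner ℝ (P.a i) x + P.b i = 0}

/-- The set of faces, including the polytope itself; the empty set is a face whenever it is an
intersection of facets. -/
def faces (P : ConvexPolytope n) : Set (Set (EuclideanSpace ℝ (Fin n))) :=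
  facesOf P.carrier P.facet

/-- A vertex is a face that consists of one point. -/
def IsVertex (P : ConvexPolytope n) (v : EuclideanSpace ℝ (Fin n)) : Prop :=
  {v} ∈ P.faces

/-- An edge is a one-dimensional face. -/
def IsEdge (P : ConvexPolytope n) (G : Set (EuclideanSpace ℝ (Fin n))) : Prop :=
  G ∈ P.faces ∧ Module.finrank ℝ (vectorSpan ℝ G) = 1

/-- Every vertex lies in exactly `n` facets. -/
def IsSimple (P : ConvexPolytope n) : Prop :=
  ∀ v, P.IsVertex v → {i | v ∈ P.facet i}.ncard = n

/-- The facet `i` of a `3`-polytope is an `s`-gon: it has exactly `s` vertices. -/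
def IsGon (P : ConvexPolytope 3) (s : ℕ) (i : Fin P.m) : Prop :=
  {v | P.IsVertex v ∧ v ∈ P.facet i}.ncard = s

/-- A fullerene: a simple convex `3`-polytope whose facets are pentagons and hexagons. -/
def IsFullerene (P : ConvexPolytope 3) : Prop :=
  P.IsSimple ∧ ∀ i, P.IsGon 5 i ∨ P.IsGon 6 i

/-- The cap: a pentagon `c` surrounded by a simple `5`-loop `p 0, …, p 4` of pentagons. -/
def ContainsCap (P : ConvexPolytope 3) : Prop :=
  ∃ (c : Fin P.m) (p : ZMod 5 → Fin P.m),
    P.IsGon 5 c ∧ (∀ i, P.IsGon 5 (p i)) ∧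
    Function.Injective p ∧ (∀ i, p i ≠ c) ∧
    (∀ i, P.IsEdge (P.facet c ∩ P.facet (p i))) ∧
    (∀ i, P.IsEdge (P.facet (p i) ∩ P.facet (p (i + 1))))

end ConvexPolytope

/-! ### The combinatorial polytopes `D k`

The surface of the dodecahedron is cut along a zigzag cycle into two caps, each a pentagon
surrounded by five pentagons, and `k` successive `5`-belts of hexagons are inserted. So there are
`k + 2` rings of five facets between the two end pentagons: ring `0` and ring `k + 1` consist of
the outer pentagons of the caps, and rings `1, …, k` are the hexagonal belts. Neighbouring rings
meet along a zigzag cycle of length `10`. -/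

/-- The facets of `D k`. -/
inductive DFacet (k : ℕ) : Type
  | top : DFacet k
  | ring (j : Fin (k + 2)) (i : ZMod 5) : DFacet k
  | bottom : DFacet k

/-- The vertices of `D k`: five on each end pentagon, and ten on each of the `k + 1` zigzag
cycles, the cycle `j` lying between the rings `j` and `j + 1`. -/
inductive DVertex (k : ℕ) : Type
  | top (i : ZMod 5) : DVertex k
  | zig (j : Fin (k + 1)) (i : ZMod 5) : DVertex k
  | zag (j : Fin (k + 1)) (i : ZMod 5) : DVertex k
  | bottom (i : ZMod 5) : DVertex k

/-- The three facets that meet at a vertex of `D k`. The facet `i` of ring `j + 1` is adjacent to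
the facets `i` and `i + 1` of ring `j`. -/
def DVertex.facets {k : ℕ} : DVertex k → Set (DFacet k)
  | .top i => {.top, .ring 0 i, .ring 0 (i + 1)}
  | .zig j i => {.ring j.castSucc i, .ring j.castSucc (i + 1), .ring j.succ i}
  | .zag j i => {.ring j.castSucc (i + 1), .ring j.succ i, .ring j.succ (i + 1)}
  | .bottom i => {.ring (Fin.last (k + 1)) i, .ring (Fin.last (k + 1)) (i + 1), .bottom}

/-- The set of vertices of a facet of `D k`. -/
def DFacet.vertices {k : ℕ} (F : DFacet k) : Set (DVertex k) :=
  {v | F ∈ v.facets}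

/-- The faces of `D k`, each given by its set of vertices: the intersections of facets. -/
def DFaces (k : ℕ) : Set (Set (DVertex k)) :=
  facesOf Set.univ (DFacet.vertices (k := k))

/-! Around a cap the fullerene is forced, ring by ring. Let five facets `y i` form a loop around the
part already built, and let `w i` be the facet across the edge of `y i` and `y (i + 1)` on the far
side. Walking around `y (i + 1)` shows that `w i = w (i + 1)` if it is a pentagon, and that `w i`
and `w (i + 1)` meet along an edge of `y (i + 1)` if it is a hexagon. So a loop with `h` hexagons
and `5 - h` pentagons would be followed by a layer of only `h` facets. For `0 < h < 5` such a layer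
cannot be filled in with pentagons and hexagons: some facet would have fewer than five sides, would
be adjacent to itself, or two different facets would coincide (`Collar.uniform`). Hence either all
`y i` are hexagons and the `w i` form the next ring, or all are pentagons and the `w i` are one
closing facet (`RingPair.next`).

The process stops (`RingChain.lt_card`): two consecutive rings determine the previous one, so a
repeated pair could be traced back until the initial ring of pentagons equals a ring of hexagons.
This gives a map from `D k` to the fullerene that respects edges, a covering. It has one sheet by
counting: by Euler's formula a fullerene has exactly 12 pentagons, all of them images of the 12
facets in the two caps of `D k`, so these have different images, some vertex has a single preimage,
and by connectedness every vertex has (`exists_ring_cover`).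

This combinatorics needs only the axioms of `CubicSphere`. For a simple polytope they come from
linear programming: edges by the ratio test, connectedness of faces by following improving edges,
Euler's formula by counting the highest and lowest vertices of facets for a generic functional. The
converse recovers vertices and facets from the order on the faces, as minimal nonempty and maximal
proper faces, and carries the cap of `D k` over. -/

/-! ### Cubic maps on the sphere, given by the facets at each vertex -/

/-- The combinatorics of a simple `3`-polytope: `N v` is the set of the three facets that meet in
the vertex `v`. -/
structure CubicSphere (V Φ : Type*) [Fintype V] [Fintype Φ] [DecidableEq Φ] where
  N : V → Finset Φ
  card_N : ∀ v, (N v).card = 3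
  exists_nbr : ∀ v, ∀ a ∈ N v, ∃ w, a ∉ N w ∧ ∀ b ∈ N v, b ≠ a → b ∈ N w
  nbr_unique : ∀ v w w', ∀ a ∈ N v, v ≠ w → v ≠ w' → (∀ b ∈ N v, b ≠ a → b ∈ N w) →
    (∀ b ∈ N v, b ≠ a → b ∈ N w') → w = w'
  connected : ∀ (v w : V) (Q : V → Prop), Q v →
    (∀ u u', Q u → N v ∩ N w ⊆ N u → N v ∩ N w ⊆ N u' → 2 ≤ (N u ∩ N u').card → Q u') → Q w
  euler : Fintype.card V + 4 = 2 * Fintype.card Φ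

namespace CubicSphere

variable {V Φ : Type*} [Fintype V] [Fintype Φ] [DecidableEq Φ] (S : CubicSphere V Φ)

theorem N_injective : Function.Injective S.N := by
  intro v v' h
  by_contra hne
  obtain ⟨a, ha⟩ : (S.N v).Nonempty := by
    rw [← Finset.card_pos, S.card_N]; norm_num
  obtain ⟨w, hw, hb⟩ := S.exists_nbr v a ha
  have hvw : v ≠ w := by rintro rfl; exact hw ha
  have := S.nbr_unique v w v' a ha hvw hne hb (fun b hb _ => h ▸ hb)
  exact hw (this ▸ h ▸ ha)

/-- The facets `a`, `b`, `c` meet in a vertex. -/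
def T (a b c : Φ) : Prop := ∃ v, S.N v = {a, b, c}

variable {S}

theorem T.rot {a b c : Φ} (h : S.T a b c) : S.T b c a := by
  obtain ⟨v, hv⟩ := h
  exact ⟨v, by rw [hv]; ext; simp; tauto⟩

theorem T.swap {a b c : Φ} (h : S.T a b c) : S.T b a c := by
  obtain ⟨v, hv⟩ := h
  exact ⟨v, by rw [hv]; ext; simp; tauto⟩

theorem T.flip {a b c : Φ} (h : S.T a b c) : S.T a c b := h.rot.swap.rot.rot

theorem T.ne {a b c : Φ} (h : S.T a b c) : a ≠ b ∧ b ≠ c ∧ a ≠ c := by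
  obtain ⟨v, hv⟩ := h
  have := S.card_N v
  rw [hv, Finset.card_eq_three] at this
  obtain ⟨x, y, z, h1, h2, h3, h⟩ := this
  have hc := S.card_N v
  rw [hv] at hc
  refine ⟨?_, ?_, ?_⟩ <;> rintro rfl
  · have : ({a, a, c} : Finset Φ).card ≤ 2 := by
      rw [Finset.insert_eq_of_mem (by simp)]; exact Finset.card_le_two
    omega
  · have : ({a, b, b} : Finset Φ).card ≤ 2 := by
      rw [Finset.insert_eq_of_mem (a := b) (by simp)]; exact Finset.card_le_two
    omega
  · have : ({a, b, a} : Finset Φ).card ≤ 2 := by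
      rw [Finset.insert_eq_of_mem (a := a) (by simp)]; exact Finset.card_le_two
    omega

theorem exists_T_of_mem {v : V} {a : Φ} (h : a ∈ S.N v) : ∃ b c, S.N v = {a, b, c} := by
  obtain ⟨x, y, z, h1, h2, h3, he⟩ := Finset.card_eq_three.1 (S.card_N v)
  rw [he] at h ⊢
  simp only [Finset.mem_insert, Finset.mem_singleton] at h
  rcases h with rfl | rfl | rfl
  · exact ⟨y, z, rfl⟩
  · exact ⟨x, z, by ext; simp; tauto⟩
  · exact ⟨x, y, by ext; simp; tauto⟩

theorem exists_T_of_mem_pair {v : V} {a b : Φ} (h : a ∈ S.N v) (hb : b ∈ S.N v) (hab : a ≠ b) :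
    ∃ c, S.N v = {a, b, c} := by
  obtain ⟨x, y, he⟩ := exists_T_of_mem h
  rw [he] at hb ⊢
  simp only [Finset.mem_insert, Finset.mem_singleton] at hb
  rcases hb with rfl | rfl | rfl
  · exact absurd rfl hab
  · exact ⟨y, rfl⟩
  · exact ⟨x, by ext; simp; tauto⟩

/-- The edge `a ∩ b` has only two ends. Together with `T.exists_opp` this lets a walk cross an edge
in exactly one way. -/
theorem T.uniq {a b c d e : Φ} (hc : S.T a b c) (hd : S.T a b d) (he : S.T a b e)
    (hdc : d ≠ c) (hec : e ≠ c) : d = e := by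
  have h1 := hc.ne
  have h2 := hd.ne
  have h3 := he.ne
  obtain ⟨v, hv⟩ := hc
  obtain ⟨w, hw⟩ := hd
  obtain ⟨w', hw'⟩ := he
  have : w = w' := by
    refine S.nbr_unique v w w' c (by simp [hv]) ?_ ?_ ?_ ?_
    · rintro rfl
      have : c ∈ S.N v := by simp [hv]
      rw [hw] at this; simp at this; grind
    · rintro rfl
      have : c ∈ S.N v := by simp [hv]
      rw [hw'] at this; simp at this; grind
    · intro x hx hxc; rw [hv] at hx; rw [hw]; simp at hx ⊢; tauto
    · intro x hx hxc; rw [hv] at hx; rw [hw']; simp at hx ⊢; tauto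
  subst this
  have : d ∈ S.N w := by simp [hw]
  rw [hw'] at this; simp at this; grind

theorem T.exists_opp {a b c : Φ} (h : S.T a b c) : ∃ d, d ≠ c ∧ S.T a b d := by
  have h1 := h.ne
  obtain ⟨v, hv⟩ := h
  obtain ⟨w, hw, hb⟩ := S.exists_nbr v c (by simp [hv])
  have ha := hb a (by simp [hv]) h1.2.2
  have hb := hb b (by simp [hv]) h1.2.1
  obtain ⟨d, hd⟩ := exists_T_of_mem_pair ha hb h1.1
  exact ⟨d, by rintro rfl; exact hw (by simp [hd]), w, hd⟩

/-! ### Cyclic order of the facets around a facet -/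

theorem pair_eq {a x y p q : Φ} (h : S.T a x y) (he : ({a, x, y} : Finset Φ) = {a, p, q}) :
    (x = p ∧ y = q) ∨ (x = q ∧ y = p) := by
  have h1 := h.ne
  have hx : x ∈ ({a, p, q} : Finset Φ) := by rw [← he]; simp
  have hy : y ∈ ({a, p, q} : Finset Φ) := by rw [← he]; simp
  simp at hx hy
  grind

/-- Two vertices of `a` are joined by a path inside `a`, since `connected` keeps all facets common
to its end points. Crossing an edge of that path replaces the pair of neighbours `x, y` by `y, z`.
-/
theorem link_induction {a : Φ} (Q : Φ → Φ → Prop) (hsymm : ∀ x y, Q x y → Q y x) {b c : Φ}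
    (h : S.T a b c) (hQ : Q b c) (step : ∀ x y z, S.T a x y → S.T a y z → Q x y → Q y z)
    {x y : Φ} (hxy : S.T a x y) : Q x y := by
  have hbc := h
  obtain ⟨v, hv⟩ := h
  have hxy' := hxy
  obtain ⟨w, hw⟩ := hxy
  refine S.connected v w (fun u => ∀ p q, S.N u = {a, p, q} → Q p q) ?_ ?_ _ _ hw
  · intro p q he
    rcases pair_eq hbc (hv.symm.trans he) with ⟨rfl, rfl⟩ | ⟨rfl, rfl⟩
    · exact hQ
    · exact hsymm _ _ hQ
  · intro u u' hu hsub hsub' hcard p q hpq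
    have ha : a ∈ S.N v ∩ S.N w := by simp [hv, hw]
    obtain ⟨s, hs, hsa⟩ := Finset.exists_mem_ne (by omega : 1 < (S.N u ∩ S.N u').card) a
    rw [Finset.mem_inter] at hs
    obtain ⟨r, hr⟩ := exists_T_of_mem_pair (hsub ha) hs.1 hsa.symm
    obtain ⟨t, ht⟩ := exists_T_of_mem_pair (hsub' ha) hs.2 hsa.symm
    have h1 : Q s t := step r s t (T.flip ⟨u, hr⟩) ⟨u', ht⟩ (hsymm _ _ (hu _ _ hr))
    rcases pair_eq ⟨u', ht⟩ (ht.symm.trans hpq) with ⟨rfl, rfl⟩ | ⟨rfl, rfl⟩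
    · exact h1
    · exact hsymm _ _ h1

variable (S) in
/-- The number of vertices of the facet `a`. -/
def deg (a : Φ) : ℕ := (Finset.univ.filter (fun v => a ∈ S.N v)).card

variable (S) in
/-- The facets `b 0, b 1, …` are met one after another on a walk around the facet `a`. -/
def LinkSeq (a : Φ) (b : ℕ → Φ) : Prop :=
  ∀ i, S.T a (b i) (b (i + 1)) ∧ b i ≠ b (i + 2)

theorem T.exists_linkSeq {a b₀ b₁ : Φ} (h : S.T a b₀ b₁) :
    ∃ b, S.LinkSeq a b ∧ b 0 = b₀ ∧ b 1 = b₁ := by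
  have key : ∀ p : {p : Φ × Φ // S.T a p.1 p.2}, ∃ q : {p : Φ × Φ // S.T a p.1 p.2},
      q.1.1 = p.1.2 ∧ q.1.2 ≠ p.1.1 := by
    rintro ⟨⟨x, y⟩, hxy⟩
    obtain ⟨d, hd, hT⟩ := hxy.flip.exists_opp
    exact ⟨⟨⟨y, d⟩, hT⟩, rfl, hd⟩
  choose f hf hf' using key
  let s : ℕ → {p : Φ × Φ // S.T a p.1 p.2} := fun n => f^[n] ⟨(b₀, b₁), h⟩
  have hs : ∀ n, s (n + 1) = f (s n) := fun n => Function.iterate_succ_apply' f n _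
  have h1 : ∀ n, (s (n + 1)).1.1 = (s n).1.2 := fun n => by rw [hs]; exact hf _
  refine ⟨fun n => (s n).1.1, fun i => ⟨?_, ?_⟩, rfl, ?_⟩
  · dsimp only
    rw [h1]; exact (s i).2
  · dsimp only
    rw [h1, hs]; exact (hf' _).symm
  · dsimp only
    rw [h1]
    rfl

theorem LinkSeq.succ_eq {a : Φ} {b : ℕ → Φ} (hb : S.LinkSeq a b) {i : ℕ} {x y z : Φ}
    (hx : b i = x) (hy : b (i + 1) = y) (hT : S.T a y z) (hne : x ≠ z) : b (i + 2) = z := by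
  subst hx hy
  exact (hb i).1.flip.uniq (hb (i + 1)).1 hT (hb i).2.symm hne.symm

/-- Neighbours on a walk determine the walk in both directions, so the shortest repetition extends
to a period; by `link_induction` one period meets every vertex of `a`, and it meets each once. -/
theorem LinkSeq.period {a : Φ} {b : ℕ → Φ} (hb : S.LinkSeq a b) :
    (∀ i, b (i + S.deg a) = b i) ∧ ∀ i m, 0 < m → m < S.deg a → b i ≠ b (i + m) := by
  classical
  have hex : ∃ m, 0 < m ∧ ∃ i, b i = b (i + m) := by
    obtain ⟨i, j, hij, he⟩ := Finite.exists_ne_map_eq_of_infinite b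
    rcases lt_or_gt_of_ne hij with h | h
    · exact ⟨j - i, by omega, i, by rw [he]; congr 1; omega⟩
    · exact ⟨i - j, by omega, j, by rw [← he]; congr 1; omega⟩
  obtain ⟨m, ⟨hm0, i, hi⟩, hmin⟩ : ∃ m, (0 < m ∧ ∃ i, b i = b (i + m)) ∧
      ∀ n, 0 < n → n < m → ∀ i, b i ≠ b (i + n) :=
    ⟨Nat.find hex, Nat.find_spec hex, fun n hn hlt i he => Nat.find_min hex hlt ⟨hn, i, he⟩⟩
  have hm3 : 3 ≤ m := by
    by_contra hlt
    have : m = 1 ∨ m = 2 := by omega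
    rcases this with rfl | rfl
    · exact (hb i).1.ne.2.1 hi
    · exact (hb i).2 hi
  obtain ⟨m, rfl⟩ : ∃ n, m = n + 2 := ⟨m - 2, by omega⟩
  -- The neighbour after `b (j + (m + 2)) = b j` must be `b (j + 1)`, because the neighbour before
  -- it is not: equality would be a repetition at the smaller distance `m`.
  have fwd : ∀ j, b j = b (j + (m + 2)) → b (j + 1) = b (j + 1 + (m + 2)) := by
    intro j hj
    have h1 : b (j + 1) ≠ b (j + m + 1) := by
      have := hmin m (by omega) (by omega) (j + 1)
      rwa [show j + 1 + m = j + m + 1 by omega] at this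
    have h3 : S.T a (b (j + (m + 2))) (b (j + 1)) := hj ▸ (hb j).1
    have := hb.succ_eq (i := j + m + 1) rfl rfl (z := b (j + 1)) h3 h1.symm
    rw [show j + 1 + (m + 2) = j + m + 1 + 2 by omega, this]
  have bwd : ∀ j, b (j + 1) = b (j + 1 + (m + 2)) → b j = b (j + (m + 2)) := by
    intro j hj
    have h2 : b (j + 2) = b (j + 2 + (m + 2)) := fwd _ hj
    have h3 := (hb (j + (m + 2))).1.flip
    have h4 := (hb (j + (m + 2))).2
    rw [show j + (m + 2) + 1 = j + 1 + (m + 2) by omega, ← hj] at h3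
    rw [show j + (m + 2) + 2 = j + 2 + (m + 2) by omega, ← h2] at h4
    exact (hb (j + 1)).1.uniq (hb j).1.flip h3 (hb j).2 h4
  have h0 : b 0 = b (0 + (m + 2)) := by
    have : ∀ j, b j = b (j + (m + 2)) → b 0 = b (0 + (m + 2)) := by
      intro j
      induction j with
      | zero => exact id
      | succ j ih => exact fun h => ih (bwd j h)
    exact this i hi
  have hper : ∀ j, b j = b (j + (m + 2)) := by
    intro j
    induction j with
    | zero => exact h0
    | succ j ih => exact fwd j ih
  have hmod : ∀ j, b j = b (j % (m + 2)) := by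
    intro j
    have : Function.Periodic b (m + 2) := fun j => (hper j).symm
    exact (this.map_mod_nat j).symm
  have hinj : ∀ i j, i < m + 2 → j < m + 2 → b i = b j → i = j := by
    intro i j hi hj he
    rcases lt_trichotomy i j with h | h | h
    · exact absurd (by rw [he]; congr 1; omega) (hmin (j - i) (by omega) (by omega) i)
    · exact h
    · exact absurd (by rw [← he]; congr 1; omega) (hmin (i - j) (by omega) (by omega) j)
  have hdeg : S.deg a = m + 2 := by
    have hv : ∀ i, ∃ v, S.N v = {a, b i, b (i + 1)} := fun i => (hb i).1
    choose f hf using hv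
    have himg : Finset.univ.filter (fun v => a ∈ S.N v) = (Finset.range (m + 2)).image f := by
      ext v
      simp only [Finset.mem_filter, Finset.mem_univ, true_and, Finset.mem_image, Finset.mem_range]
      constructor
      · intro hv
        obtain ⟨x, y, hxy⟩ := exists_T_of_mem hv
        have hQ := link_induction (S := S) (a := a)
          (fun x y => ∃ i, (x = b i ∧ y = b (i + 1)) ∨ (y = b i ∧ x = b (i + 1)))
          (fun x y ⟨i, h⟩ => ⟨i, h.symm⟩) (hb 0).1 ⟨0, Or.inl ⟨rfl, rfl⟩⟩ ?_ ⟨v, hxy⟩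
        · obtain ⟨i, hi⟩ := hQ
          refine ⟨i % (m + 2), Nat.mod_lt _ (by omega), S.N_injective ?_⟩
          have e1 : b (i % (m + 2)) = b i := (hmod i).symm
          have e2 : b (i % (m + 2) + 1) = b (i + 1) := by
            rw [hmod (i + 1), hmod (i % (m + 2) + 1)]; simp
          rw [hf, hxy, e1, e2]
          rcases hi with ⟨rfl, rfl⟩ | ⟨rfl, rfl⟩
          · rfl
          · ext; simp; tauto
        · rintro x y z h1 h2 ⟨i, ⟨rfl, rfl⟩ | ⟨rfl, rfl⟩⟩
          · by_cases hz : b i = z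
            · exact ⟨i, Or.inr ⟨hz.symm, rfl⟩⟩
            · exact ⟨i + 1, Or.inl ⟨rfl, (hb.succ_eq rfl rfl h2 hz).symm⟩⟩
          · by_cases hz : z = b (i + 1)
            · exact ⟨i, Or.inl ⟨rfl, hz⟩⟩
            · refine ⟨i + (m + 1), Or.inr ⟨?_, ?_⟩⟩
              · have h5 := (hb (i + (m + 1))).1
                have h6 := (hb (i + (m + 1))).2
                rw [show i + (m + 1) + 1 = i + (m + 2) by omega, ← hper] at h5
                rw [show i + (m + 1) + 2 = i + 1 + (m + 2) by omega, ← hper] at h6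
                exact (hb i).1.uniq h2 h5.flip hz h6
              · rw [hper, show i + (m + 1) + 1 = i + (m + 2) by omega]
      · rintro ⟨i, -, rfl⟩
        simp [hf]
    rw [deg, himg, Finset.card_image_of_injOn, Finset.card_range]
    intro i hi j hj hij
    simp only [Finset.coe_range, Set.mem_Iio] at hi hj
    have he : ({a, b i, b (i + 1)} : Finset Φ) = {a, b j, b (j + 1)} := by
      rw [← hf, ← hf]; exact congrArg _ hij
    rcases pair_eq (hb i).1 he with ⟨h, -⟩ | ⟨h1, h2⟩
    · exact hinj _ _ hi hj h
    -- The same vertex met in the opposite direction would give `b i = b (i + 2)`, which a walk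
    -- excludes.
    · exfalso
      have e1 : i = (j + 1) % (m + 2) :=
        hinj _ _ hi (Nat.mod_lt _ (by omega)) (by rw [← hmod]; exact h1)
      have e2 : (i + 1) % (m + 2) = j :=
        hinj _ _ (Nat.mod_lt _ (by omega)) hj (by rw [← hmod]; exact h2)
      have e3 : b i = b (i + 2) := by
        rw [← e2, Nat.mod_add_mod] at e1
        rw [hmod (i + 2)]
        exact congrArg b e1
      exact (hb i).2 e3
  rw [hdeg]
  exact ⟨fun i => (hper i).symm, fun i n h1 h2 => hmin n h1 h2 i⟩

end CubicSphere

/-! ### Walks around pentagons and hexagons -/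

namespace CubicSphere

variable {V Φ : Type*} [Fintype V] [Fintype Φ] [DecidableEq Φ] {S : CubicSphere V Φ}

theorem link_five {a b₀ b₁ b₂ b₃ b₄ : Φ} (ha : S.deg a = 5) (h₀ : S.T a b₀ b₁) (h₁ : S.T a b₁ b₂)
    (h₂ : S.T a b₂ b₃) (h₃ : S.T a b₃ b₄) (n₀ : b₀ ≠ b₂) (n₁ : b₁ ≠ b₃) (n₂ : b₂ ≠ b₄) :
    S.T a b₄ b₀ := by
  obtain ⟨b, hb, e₀, e₁⟩ := h₀.exists_linkSeq
  have e₂ := hb.succ_eq e₀ e₁ h₁ n₀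
  have e₃ := hb.succ_eq e₁ e₂ h₂ n₁
  have e₄ := hb.succ_eq e₂ e₃ h₃ n₂
  have e₅ := hb.period.1 0
  have h := (hb 4).1
  rw [ha] at e₅
  simp only [zero_add] at e₅ e₂ e₃ e₄
  norm_num at h e₄
  rwa [e₅, e₀, e₄] at h

theorem link_six {a b₀ b₁ b₂ b₃ b₄ b₅ : Φ} (ha : S.deg a = 6) (h₀ : S.T a b₀ b₁)
    (h₁ : S.T a b₁ b₂) (h₂ : S.T a b₂ b₃) (h₃ : S.T a b₃ b₄) (h₄ : S.T a b₄ b₅)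
    (n₀ : b₀ ≠ b₂) (n₁ : b₁ ≠ b₃) (n₂ : b₂ ≠ b₄) (n₃ : b₃ ≠ b₅) :
    S.T a b₅ b₀ := by
  obtain ⟨b, hb, e₀, e₁⟩ := h₀.exists_linkSeq
  have e₂ := hb.succ_eq e₀ e₁ h₁ n₀
  have e₃ := hb.succ_eq e₁ e₂ h₂ n₁
  have e₄ := hb.succ_eq e₂ e₃ h₃ n₂
  have e₅ := hb.succ_eq e₃ e₄ h₄ n₃
  have e₆ := hb.period.1 0
  have h := (hb 5).1
  rw [ha] at e₆
  norm_num at h e₂ e₃ e₄ e₅ e₆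
  rwa [e₆, e₀, e₅] at h

theorem link_ne_three {a b₀ b₁ b₂ b₃ : Φ} (ha : 3 < S.deg a) (h₀ : S.T a b₀ b₁)
    (h₁ : S.T a b₁ b₂) (h₂ : S.T a b₂ b₃) (n₀ : b₀ ≠ b₂) (n₁ : b₁ ≠ b₃) : b₀ ≠ b₃ := by
  obtain ⟨b, hb, e₀, e₁⟩ := h₀.exists_linkSeq
  have e₂ := hb.succ_eq e₀ e₁ h₁ n₀
  have e₃ := hb.succ_eq e₁ e₂ h₂ n₁
  rw [← e₀, ← e₃]
  exact hb.period.2 0 3 (by norm_num) ha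

theorem link_ne_four {a b₀ b₁ b₂ b₃ b₄ : Φ} (ha : 4 < S.deg a) (h₀ : S.T a b₀ b₁)
    (h₁ : S.T a b₁ b₂) (h₂ : S.T a b₂ b₃) (h₃ : S.T a b₃ b₄) (n₀ : b₀ ≠ b₂) (n₁ : b₁ ≠ b₃)
    (n₂ : b₂ ≠ b₄) : b₀ ≠ b₄ := by
  obtain ⟨b, hb, e₀, e₁⟩ := h₀.exists_linkSeq
  have e₂ := hb.succ_eq e₀ e₁ h₁ n₀
  have e₃ := hb.succ_eq e₁ e₂ h₂ n₁
  have e₄ := hb.succ_eq e₂ e₃ h₃ n₂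
  rw [← e₀, ← e₄]
  exact hb.period.2 0 4 (by norm_num) ha

theorem link_ne_five {a b₀ b₁ b₂ b₃ b₄ b₅ : Φ} (ha : 5 < S.deg a) (h₀ : S.T a b₀ b₁)
    (h₁ : S.T a b₁ b₂) (h₂ : S.T a b₂ b₃) (h₃ : S.T a b₃ b₄) (h₄ : S.T a b₄ b₅)
    (n₀ : b₀ ≠ b₂) (n₁ : b₁ ≠ b₃) (n₂ : b₂ ≠ b₄) (n₃ : b₃ ≠ b₅) : b₀ ≠ b₅ := by
  obtain ⟨b, hb, e₀, e₁⟩ := h₀.exists_linkSeq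
  have e₂ := hb.succ_eq e₀ e₁ h₁ n₀
  have e₃ := hb.succ_eq e₁ e₂ h₂ n₁
  have e₄ := hb.succ_eq e₂ e₃ h₃ n₂
  have e₅ := hb.succ_eq e₃ e₄ h₄ n₃
  rw [← e₀, ← e₅]
  exact hb.period.2 0 5 (by norm_num) ha

theorem link_five_eq {a b₀ b₁ b₂ b₃ b₄ b₅ : Φ} (ha : S.deg a = 5) (h₀ : S.T a b₀ b₁)
    (h₁ : S.T a b₁ b₂) (h₂ : S.T a b₂ b₃) (h₃ : S.T a b₃ b₄) (h₄ : S.T a b₄ b₅)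
    (n₀ : b₀ ≠ b₂) (n₁ : b₁ ≠ b₃) (n₂ : b₂ ≠ b₄) (n₃ : b₃ ≠ b₅) : b₀ = b₅ :=
  h₃.flip.uniq (link_five ha h₀ h₁ h₂ h₃ n₀ n₁ n₂) h₄
    (link_ne_three (by omega) h₀ h₁ h₂ n₀ n₁) n₃.symm

/-- Five consecutive neighbours of a hexagon leave room for exactly one more, `v`. -/
theorem link_six_exists {a b₀ b₁ b₂ b₃ b₄ : Φ} (ha : S.deg a = 6) (h₀ : S.T a b₀ b₁)
    (h₁ : S.T a b₁ b₂) (h₂ : S.T a b₂ b₃) (h₃ : S.T a b₃ b₄)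
    (n₀ : b₀ ≠ b₂) (n₁ : b₁ ≠ b₃) (n₂ : b₂ ≠ b₄) :
    ∃ v, S.T a b₄ v ∧ S.T a v b₀ ∧ v ≠ b₃ ∧ v ≠ b₁ := by
  obtain ⟨v, hv, h₄⟩ := h₃.flip.exists_opp
  refine ⟨v, h₄, link_six ha h₀ h₁ h₂ h₃ h₄ n₀ n₁ n₂ hv.symm, hv, ?_⟩
  exact (link_ne_four (by omega) h₁ h₂ h₃ h₄ n₁ n₂ hv.symm).symm

variable (S) in
/-- All facets are pentagons and hexagons. -/
def FiveSix : Prop := ∀ a, S.deg a = 5 ∨ S.deg a = 6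

theorem FiveSix.lt (hd : S.FiveSix) (a : Φ) : 4 < S.deg a := by
  rcases hd a with h | h <;> omega

/-! ### Layers of fewer than five facets are impossible -/

theorem not_link_three (hd : S.FiveSix) {a x y z : Φ} (h₀ : S.T a x y) (h₁ : S.T a y z)
    (h₂ : S.T a z x) : False :=
  link_ne_three (by have := hd.lt a; omega) h₀ h₁ h₂ h₂.ne.2.1.symm h₀.ne.2.1.symm rfl

theorem not_link_four (hd : S.FiveSix) {a x y z t : Φ} (h₀ : S.T a x y) (h₁ : S.T a y z)
    (h₂ : S.T a z t) (h₃ : S.T a t x) (n₀ : x ≠ z) (n₁ : y ≠ t) : False :=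
  link_ne_four (hd.lt a) h₀ h₁ h₂ h₃ n₀ n₁ n₀.symm rfl

/-- The facet `w` would be a triangle with neighbours `z₀`, `z₁`, `w'`. -/
theorem not_layer_two (hd : S.FiveSix) {z₀ z₁ w w' : Φ} (h : S.T z₀ z₁ w) (h₀ : S.T z₀ w' w)
    (h₁ : S.T z₁ w w') : False :=
  not_link_three hd h.rot.rot h₁.swap h₀.rot.swap

/-- The digits count the outer facets that `A`, `B`, `C` meet. The three cannot share a vertex, or
`A` would be a quadrilateral; so `B` and `C` are hexagons, their sixth neighbours agree across the
edge `B ∩ C`, and that common neighbour is a triangle. -/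
theorem not_layer_three_233 (hd : S.FiveSix) {A B C x y t z z' : Φ}
    (hAB : S.T A B y) (hBC : S.T B C t) (hCA : S.T C A x) (hA : S.T A x y)
    (hB₁ : S.T B y z) (hB₂ : S.T B z t) (hC₁ : S.T C t z') (hC₂ : S.T C z' x)
    (n₁ : C ≠ y) (n₂ : x ≠ B) (n₃ : A ≠ z) (n₄ : y ≠ t) (n₅ : z ≠ C) (n₆ : B ≠ z')
    (n₇ : t ≠ x) (n₈ : z' ≠ A) : False := by
  have ncl : ¬ S.T A B C := fun h => not_link_four hd hCA.swap hA hAB.flip h n₁ n₂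
  rcases hd B with h5 | h6
  · exact ncl (link_five h5 hAB.swap hB₁ hB₂ hBC.flip n₃ n₄ n₅).rot.rot
  obtain ⟨v, hv₁, hv₂, hv₃, -⟩ := link_six_exists h6 hAB.swap hB₁ hB₂ hBC.flip n₃ n₄ n₅
  rcases hd C with h5 | h6
  · exact ncl (link_five h5 hBC.swap hC₁ hC₂ hCA.flip n₆ n₇ n₈).rot
  obtain ⟨v', hv'₁, hv'₂, -, hv'₃⟩ := link_six_exists h6 hBC.swap hC₁ hC₂ hCA.flip n₆ n₇ n₈
  obtain rfl : v = v' := hBC.uniq hv₁ hv'₂.rot.rot hv₃ hv'₃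
  exact not_link_three hd hv₂.rot hv₁.rot.rot hv'₁.rot.rot

/-- Four outer facets, `B` and `C` use up all six places around `A`: a pentagon forces `B = C`, and
a hexagon makes `A`, `B`, `C` share a vertex, so that `B` is a quadrilateral. -/
theorem not_layer_three_224 (hd : S.FiveSix) {A B C x y t z z' : Φ}
    (hAB : S.T A B y) (hBC : S.T B C t) (hCA : S.T C A x) (hA₁ : S.T A x z) (hA₂ : S.T A z z')
    (hA₃ : S.T A z' y) (hB : S.T B y t) (n₁ : C ≠ z) (n₂ : x ≠ z') (n₃ : z ≠ y) (n₄ : z' ≠ B)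
    (n₅ : A ≠ t) (n₆ : y ≠ C) : False := by
  have ncl : ¬ S.T A B C := fun h => not_link_four hd hAB.swap hB hBC.flip h.rot n₅ n₆
  rcases hd A with h5 | h6
  · exact hBC.ne.1 (link_five_eq h5 hCA.swap hA₁ hA₂ hA₃ hAB.flip n₁ n₂ n₃ n₄).symm
  · exact ncl (link_six h6 hCA.swap hA₁ hA₂ hA₃ hAB.flip n₁ n₂ n₃ n₄)

/-- Here the outer loop has four facets; the case arises one layer inside the configuration of
`not_layer_four_3222`. All of `A`, `B`, `C` must be hexagons, and then the facet `u` across `A ∩ B`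
is a triangle. -/
theorem not_layer_three_223 (hd : S.FiveSix) {A B C x y t z : Φ}
    (hAB : S.T A B y) (hBC : S.T B C t) (hCA : S.T C A x) (hA : S.T A x y)
    (hB : S.T B y t) (hC₁ : S.T C t z) (hC₂ : S.T C z x)
    (n₁ : C ≠ y) (n₂ : x ≠ B) (n₃ : A ≠ t) (n₄ : B ≠ z)
    (n₅ : t ≠ x) (n₆ : z ≠ A) : False := by
  have ncl : ¬ S.T A B C := fun h => not_link_four hd hCA.swap hA hAB.flip h n₁ n₂
  obtain ⟨u, hu, hABu⟩ := hAB.exists_opp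
  rcases hd C with h5 | h6
  · exact ncl (link_five h5 hBC.swap hC₁ hC₂ hCA.flip n₄ n₅ n₆).rot
  obtain ⟨v, hv₁, hv₂, hv₃, hv₄⟩ := link_six_exists h6 hBC.swap hC₁ hC₂ hCA.flip n₄ n₅ n₆
  have huv : u ≠ v := by
    rintro rfl
    exact not_link_three hd hABu.rot.rot hv₂.rot hv₁.rot.rot
  rcases hd A with h5 | hA6
  · exact huv (link_five_eq h5 hv₁.rot hCA.swap hA hAB.flip hABu hv₃ n₁ n₂ hu.symm).symm
  rcases hd B with h5 | hB6
  · exact huv (link_five_eq h5 hABu.rot hAB.swap hB hBC.flip hv₂.rot.rot hu n₃ n₁.symm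
      hv₄.symm)
  have h₁ := link_six hA6 hv₁.rot hCA.swap hA hAB.flip hABu hv₃ n₁ n₂ hu.symm
  have h₂ := link_six hB6 hABu.rot hAB.swap hB hBC.flip hv₂.rot.rot hu n₃ n₁.symm hv₄.symm
  exact not_link_three hd hABu.rot.rot h₂.rot.rot h₁.rot

/-- If `A` is a pentagon, then `C`, `D`, `B` form a layer of type 233 with `A` in the outer loop. If
`A` is a hexagon, one looks at the next layer: `v` beyond `A`, `p` beyond `B ∩ C`, `q` beyond `C ∩
D`, where each pentagon among `B`, `C`, `D` identifies two of them. -/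
theorem not_layer_four_3222 (hd : S.FiveSix) {A B C D z₀ z₁ z₂ z₃ z₄ : Φ}
    (hAB : S.T A B z₁) (hBC : S.T B C z₂) (hCD : S.T C D z₃) (hDA : S.T D A z₄)
    (hA₁ : S.T A z₄ z₀) (hA₂ : S.T A z₀ z₁) (hB : S.T B z₁ z₂) (hC : S.T C z₂ z₃)
    (hD : S.T D z₃ z₄) (n₁ : D ≠ z₀) (n₂ : z₄ ≠ z₁) (n₃ : z₀ ≠ B) (n₄ : A ≠ z₂) (n₅ : z₁ ≠ C)
    (n₆ : B ≠ z₃) (n₇ : z₂ ≠ D) (n₈ : C ≠ z₄) (n₉ : z₃ ≠ A) : False := by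
  have hl := hd.lt
  have hl' : ∀ a, 3 < S.deg a := fun a => by have := hd.lt a; omega
  have m₁ : D ≠ B := link_ne_four (hl A) hDA.swap hA₁ hA₂ hAB.flip n₁ n₂ n₃
  have m₂ : A ≠ C := link_ne_three (hl' B) hAB.swap hB hBC.flip n₄ n₅
  rcases hd A with h5 | h6
  · have h := link_five h5 hDA.swap hA₁ hA₂ hAB.flip n₁ n₂ n₃
    exact not_layer_three_233 hd hCD h.rot.swap hBC hC hD hDA.flip hAB.swap hB n₆ n₇ n₈ n₉
      (link_ne_three (hl' A) hA₁ hA₂ hAB.flip n₂ n₃)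
      (link_ne_three (hl' A) hDA.swap hA₁ hA₂ n₁ n₂) n₄ n₅
  obtain ⟨v, hv₁, hv₂, hv₃, hv₄⟩ := link_six_exists h6 hDA.swap hA₁ hA₂ hAB.flip n₁ n₂ n₃
  obtain ⟨p, hp, hBCp⟩ := hBC.exists_opp
  obtain ⟨q, hq, hCDq⟩ := hCD.exists_opp
  have hB' : v = p ∨ S.T B p v := by
    rcases hd B with h | h
    · exact .inl (link_five_eq h hv₁.rot hAB.swap hB hBC.flip hBCp hv₃ n₄ n₅ hp.symm)
    · exact .inr (link_six h hv₁.rot hAB.swap hB hBC.flip hBCp hv₃ n₄ n₅ hp.symm)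
  have hC' : p = q ∨ S.T C q p := by
    rcases hd C with h | h
    · exact .inl (link_five_eq h hBCp.rot hBC.swap hC hCD.flip hCDq hp n₆ n₇ hq.symm)
    · exact .inr (link_six h hBCp.rot hBC.swap hC hCD.flip hCDq hp n₆ n₇ hq.symm)
  have hD' : q = v ∨ S.T D v q := by
    rcases hd D with h | h
    · exact .inl (link_five_eq h hCDq.rot hCD.swap hD hDA.flip hv₂.rot.rot hq n₈ n₉ hv₄.symm)
    · exact .inr (link_six h hCDq.rot hCD.swap hD hDA.flip hv₂.rot.rot hq n₈ n₉ hv₄.symm)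
  have k₁ : v ≠ C := link_ne_four (hl B) hv₁.rot hAB.swap hB hBC.flip hv₃ n₄ n₅
  have k₂ : A ≠ p := link_ne_four (hl B) hAB.swap hB hBC.flip hBCp n₄ n₅ hp.symm
  have k₃ : p ≠ D := link_ne_four (hl C) hBCp.rot hBC.swap hC hCD.flip hp n₆ n₇
  have k₄ : B ≠ q := link_ne_four (hl C) hBC.swap hC hCD.flip hCDq n₆ n₇ hq.symm
  have k₅ : q ≠ A := link_ne_four (hl D) hCDq.rot hCD.swap hD hDA.flip hq n₈ n₉
  -- All pentagons: `v` is a quadrilateral. Exactly one hexagon: a facet is adjacent to itself. Two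
  -- hexagons: a layer of two, or `p` is a quadrilateral. Three: `p`, `q`, `v` form a layer of type
  -- 223 inside the loop `A`, `B`, `C`, `D`.
  rcases hB' with e₁ | hB' <;> rcases hC' with e₂ | hC' <;> rcases hD' with e₃ | hD'
  · subst e₁ e₂
    exact not_link_four hd hv₁.rot.rot hBCp.rot.rot hCDq.rot.rot hv₂.rot m₂ m₁.symm
  · subst e₁ e₂
    exact hD'.ne.2.1 rfl
  · subst e₁ e₃
    exact hC'.ne.2.1 rfl
  · subst e₁
    exact not_layer_two hd hCDq hC'.flip hD'.flip
  · subst e₂ e₃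
    exact hB'.ne.2.1 rfl
  · subst e₂
    exact not_link_four hd hBCp.rot.rot hCDq.rot.rot hD'.rot.rot hB'.rot m₁.symm k₁.symm
  · subst e₃
    exact not_layer_two hd hBCp hB'.flip hC'.flip
  · exact not_layer_three_223 hd hC'.rot.swap hD'.rot.swap hB'.rot.swap hBCp.rot.rot hCDq.rot.rot
      hv₂.rot hv₁.rot.rot k₁ k₄ k₃ k₅ m₁ k₂

/-! ### Five-loops consist of one kind of facet -/

variable (S) in
/-- The facets `w i` surround a loop of five facets `z i`. -/
structure Collar (z w : ZMod 5 → Φ) : Prop where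
  tri : ∀ i, S.T (z i) (z (i + 1)) (w i)
  zz : ∀ i, z i ≠ z (i + 2)
  wz : ∀ i, w i ≠ z (i + 2)
  zw : ∀ i, z i ≠ w (i + 1)

theorem Collar.shift {z w : ZMod 5 → Φ} (h : S.Collar z w) (s : ZMod 5) :
    S.Collar (fun i => z (s + i)) (fun i => w (s + i)) where
  tri i := by simpa only [add_assoc] using h.tri (s + i)
  zz i := by simpa only [add_assoc] using h.zz (s + i)
  wz i := by simpa only [add_assoc] using h.wz (s + i)
  zw i := by simpa only [add_assoc] using h.zw (s + i)

/-- There are eight binary necklaces of length five: two constant ones and the six listed. -/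
theorem exists_shift_pattern (p : ZMod 5 → Bool) : (∀ i, p i = true) ∨ (∀ i, p i = false) ∨
    ∃ s, (p s, p (s + 1), p (s + 2), p (s + 3), p (s + 4)) ∈
      [(true, false, false, false, false), (true, true, false, false, false),
       (true, false, true, false, false), (true, true, true, false, false),
       (true, true, false, true, false), (true, true, true, true, false)] := by
  have key : ∀ p : Fin 5 → Bool, (∀ i, p i = true) ∨ (∀ i, p i = false) ∨
    ∃ s, (p s, p (s + 1), p (s + 2), p (s + 3), p (s + 4)) ∈
      [(true, false, false, false, false), (true, true, false, false, false),
       (true, false, true, false, false), (true, true, true, false, false),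
       (true, true, false, true, false), (true, true, true, true, false)] := by decide
  exact key p

/-- The value `true` marks a hexagon. A mixed pattern makes the `w i` collapse to a layer of one to
four facets, and each such layer is excluded. -/
theorem Collar.uniform (hd : S.FiveSix) {z w : ZMod 5 → Φ} (h : S.Collar z w) (p : ZMod 5 → Bool)
    (h6 : ∀ i, p (i + 1) = true → S.T (z (i + 1)) (w i) (w (i + 1)))
    (h5 : ∀ i, p (i + 1) = false → w i = w (i + 1)) :
    (∀ i, p i = true) ∨ (∀ i, p i = false) := by
  rcases exists_shift_pattern p with hp | hp | ⟨s, hs⟩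
  · exact .inl hp
  · exact .inr hp
  exfalso
  have hc := h.shift s
  have h6 : ∀ i, p (s + (i + 1)) = true → S.T (z (s + (i + 1))) (w (s + i)) (w (s + (i + 1))) := by
    intro i; simpa only [add_assoc] using h6 (s + i)
  have h5 : ∀ i, p (s + (i + 1)) = false → w (s + i) = w (s + (i + 1)) := by
    intro i; simpa only [add_assoc] using h5 (s + i)
  rw [show p s = p (s + 0) by simp] at hs
  generalize hP : (fun i => p (s + i)) = P at *
  generalize hZ : (fun i => z (s + i)) = Z at *
  generalize hW : (fun i => w (s + i)) = W at *
  replace h6 : ∀ i, P (i + 1) = true → S.T (Z (i + 1)) (W i) (W (i + 1)) := by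
    subst hP hZ hW; exact h6
  replace h5 : ∀ i, P (i + 1) = false → W i = W (i + 1) := by
    subst hP hW; exact h5
  rw [show p (s + 0) = P 0 by rw [← hP], show p (s + 1) = P 1 by rw [← hP],
    show p (s + 2) = P 2 by rw [← hP], show p (s + 3) = P 3 by rw [← hP],
    show p (s + 4) = P 4 by rw [← hP]] at hs
  have t₀ : S.T (Z 0) (Z 1) (W 0) := hc.tri 0
  have t₁ : S.T (Z 1) (Z 2) (W 1) := hc.tri 1
  have t₂ : S.T (Z 2) (Z 3) (W 2) := hc.tri 2
  have t₃ : S.T (Z 3) (Z 4) (W 3) := hc.tri 3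
  have t₄ : S.T (Z 4) (Z 0) (W 4) := hc.tri 4
  have zz₀ : Z 0 ≠ Z 2 := hc.zz 0
  have zz₁ : Z 1 ≠ Z 3 := hc.zz 1
  have zz₂ : Z 2 ≠ Z 4 := hc.zz 2
  have zz₃ : Z 3 ≠ Z 0 := hc.zz 3
  have wz₀ : W 0 ≠ Z 2 := hc.wz 0
  have wz₁ : W 1 ≠ Z 3 := hc.wz 1
  have wz₂ : W 2 ≠ Z 4 := hc.wz 2
  have wz₄ : W 4 ≠ Z 1 := hc.wz 4
  have zw₀ : Z 0 ≠ W 1 := hc.zw 0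
  have zw₁ : Z 1 ≠ W 2 := hc.zw 1
  have zw₂ : Z 2 ≠ W 3 := hc.zw 2
  have zw₄ : Z 4 ≠ W 0 := hc.zw 4
  have a₀ : P 0 = true → S.T (Z 0) (W 4) (W 0) := h6 4
  have a₁ : P 1 = true → S.T (Z 1) (W 0) (W 1) := h6 0
  have a₂ : P 2 = true → S.T (Z 2) (W 1) (W 2) := h6 1
  have a₃ : P 3 = true → S.T (Z 3) (W 2) (W 3) := h6 2
  have b₁ : P 1 = false → W 0 = W 1 := h5 0
  have b₂ : P 2 = false → W 1 = W 2 := h5 1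
  have b₃ : P 3 = false → W 2 = W 3 := h5 2
  have b₄ : P 4 = false → W 3 = W 4 := h5 3
  simp only [List.mem_cons, Prod.mk.injEq, List.not_mem_nil, or_false] at hs
  -- The `W i` reduce to one facet adjacent to itself, to two facets one of which is a triangle or a
  -- quadrilateral, to layers of type 224 and 233, and to a layer of type 3222.
  rcases hs with h | h | h | h | h | h <;> obtain ⟨h₀, h₁, h₂, h₃, h₄⟩ := h
  · exact (a₀ h₀).ne.2.1 (by rw [b₁ h₁, b₂ h₂, b₃ h₃, b₄ h₄])
  · have e : W 4 = W 1 := by rw [b₂ h₂, b₃ h₃, b₄ h₄]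
    exact not_layer_two hd t₀ (e ▸ a₀ h₀) (a₁ h₁)
  · have e : W 4 = W 2 := by rw [b₃ h₃, b₄ h₄]
    have e' := b₁ h₁
    have u := a₀ h₀
    have u' := a₂ h₂
    rw [e] at u
    rw [← e'] at t₁ u'
    exact not_link_four hd t₀.rot.rot t₁.rot.rot u'.swap u.rot.swap zz₀ zw₁
  · have e : W 4 = W 2 := by rw [b₃ h₃, b₄ h₄]
    have u := a₀ h₀
    rw [e] at t₄ u
    rw [← b₃ h₃] at t₃
    exact not_layer_three_224 hd u.rot (a₁ h₁).rot (a₂ h₂).rot t₂.rot.rot t₃.rot.rot t₄.rot.rot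
      t₀.rot.rot wz₁ zz₂ zz₃ zw₄ zw₁.symm zw₀
  · have u := a₀ h₀
    have u' := a₃ h₃
    rw [← b₄ h₄] at u t₄ wz₄
    rw [← b₂ h₂] at t₂ u' wz₂
    exact not_layer_three_233 hd (a₁ h₁).rot u'.rot u.rot t₀.rot.rot t₁.rot.rot t₂.rot.rot
      t₃.rot.rot t₄.rot.rot wz₄ zw₀ wz₀ zz₁ zw₂ wz₂ zz₃ zw₄
  · have u := a₀ h₀
    rw [← b₄ h₄] at u t₄ wz₄
    exact not_layer_four_3222 hd u.rot (a₁ h₁).rot (a₂ h₂).rot (a₃ h₃).rot t₃.rot.rot t₄.rot.rot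
      t₀.rot.rot t₁.rot.rot t₂.rot.rot wz₂ zz₃ zw₄ wz₄ zw₀ wz₀ zw₁ wz₁ zw₂

end CubicSphere

/-! ### Growing rings from the cap until they close -/

namespace CubicSphere

variable {V Φ : Type*} [Fintype V] [Fintype Φ] [DecidableEq Φ] {S : CubicSphere V Φ}

variable (S) in
/-- The facets `y i` form a loop that surrounds the loop of the facets `x i`, along a zigzag
cycle. -/
structure RingPair (x y : ZMod 5 → Φ) : Prop where
  zig : ∀ i, S.T (x i) (x (i + 1)) (y i)
  zag : ∀ i, S.T (x (i + 1)) (y i) (y (i + 1))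
  yx : ∀ i, y i ≠ x (i + 2)
  xy : ∀ i, x i ≠ y (i + 1)

/-- Around `y (i + 1)` one meets `w i`, `y i`, `x (i + 1)`, `x (i + 2)`, `y (i + 2)`, `w (i + 1)` in
this order, so the number of its sides decides whether the ends coincide or are adjacent.
`Collar.uniform` makes the answer the same for all `i`. -/
theorem RingPair.next (hd : S.FiveSix) {x y : ZMod 5 → Φ} (h : S.RingPair x y) :
    ∃ w : ZMod 5 → Φ, (∀ i, S.T (y i) (y (i + 1)) (w i)) ∧ (∀ i, w i ≠ x (i + 1)) ∧
      (((∀ i, S.deg (y i) = 6) ∧ S.RingPair y w) ∨ ((∀ i, S.deg (y i) = 5) ∧ ∀ i, w i = w 0)) := by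
  have hw : ∀ i, ∃ d, d ≠ x (i + 1) ∧ S.T (y i) (y (i + 1)) d := fun i => (h.zag i).rot.exists_opp
  choose w hwx hw using hw
  have hl := hd.lt
  have hl' : ∀ a, 3 < S.deg a := fun a => by have := hd.lt a; omega
  have p₁ : ∀ i, S.T (y (i + 1)) (w i) (y i) := fun i => (hw i).rot
  have p₂ : ∀ i, S.T (y (i + 1)) (y i) (x (i + 1)) := fun i => (h.zag i).rot.swap
  have p₃ : ∀ i, S.T (y (i + 1)) (x (i + 1)) (x (i + 2)) := fun i => by
    have := (h.zig (i + 1)).rot.rot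
    rwa [show i + 1 + 1 = i + 2 by ring] at this
  have p₄ : ∀ i, S.T (y (i + 1)) (x (i + 2)) (y (i + 2)) := fun i => by
    have := (h.zag (i + 1)).swap
    rwa [show i + 1 + 1 = i + 2 by ring] at this
  have p₅ : ∀ i, S.T (y (i + 1)) (y (i + 2)) (w (i + 1)) := fun i => by
    have := hw (i + 1)
    rwa [show i + 1 + 1 = i + 2 by ring] at this
  have n₃ : ∀ i, x (i + 1) ≠ y (i + 2) := fun i => by
    have := h.xy (i + 1)
    rwa [show i + 1 + 1 = i + 2 by ring] at this
  have n₄ : ∀ i, x (i + 2) ≠ w (i + 1) := fun i => by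
    have := (hwx (i + 1)).symm
    rwa [show i + 1 + 1 = i + 2 by ring] at this
  have hc : S.Collar y w :=
    { tri := hw
      zz := fun i => link_ne_three (hl' _) (p₂ i) (p₃ i) (p₄ i) (h.yx i) (n₃ i)
      wz := fun i => link_ne_four (hl _) (p₁ i) (p₂ i) (p₃ i) (p₄ i) (hwx i) (h.yx i) (n₃ i)
      zw := fun i => link_ne_four (hl _) (p₂ i) (p₃ i) (p₄ i) (p₅ i) (h.yx i) (n₃ i) (n₄ i) }
  have h6 : ∀ i, S.deg (y (i + 1)) = 6 → S.T (y (i + 1)) (w i) (w (i + 1)) := fun i hi =>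
    (link_six hi (p₁ i) (p₂ i) (p₃ i) (p₄ i) (p₅ i) (hwx i) (h.yx i) (n₃ i) (n₄ i)).flip
  have h5 : ∀ i, S.deg (y (i + 1)) = 5 → w i = w (i + 1) := fun i hi =>
    link_five_eq hi (p₁ i) (p₂ i) (p₃ i) (p₄ i) (p₅ i) (hwx i) (h.yx i) (n₃ i) (n₄ i)
  refine ⟨w, hw, hwx, ?_⟩
  rcases hc.uniform hd (fun i => decide (S.deg (y i) = 6)) (fun i hi => h6 i (by simpa using hi))
    (fun i hi => h5 i ((hd _).resolve_right (by simpa using hi))) with hp | hp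
  · left
    have hp : ∀ i, S.deg (y i) = 6 := fun i => by simpa using hp i
    exact ⟨hp, hw, fun i => h6 i (hp _), hc.wz, hc.zw⟩
  · right
    have hp : ∀ i, S.deg (y i) = 5 := fun i => (hd _).resolve_right (by simpa using hp i)
    refine ⟨hp, ?_⟩
    have e : ∀ i, w i = w (i + 1) := fun i => h5 i (hp _)
    have e₀ : w 0 = w 1 := e 0
    have e₁ : w 1 = w 2 := e 1
    have e₂ : w 2 = w 3 := e 2
    have e₃ : w 3 = w 4 := e 3
    intro i
    have : i = 0 ∨ i = 1 ∨ i = 2 ∨ i = 3 ∨ i = 4 := by revert i; decide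
    rcases this with rfl | rfl | rfl | rfl | rfl
    · rfl
    · rw [e₀]
    · rw [e₀, e₁]
    · rw [e₀, e₁, e₂]
    · rw [e₀, e₁, e₂, e₃]

theorem RingPair.zz (hd : S.FiveSix) {x y : ZMod 5 → Φ} (h : S.RingPair x y) (i : ZMod 5) :
    y i ≠ y (i + 2) := by
  have h1 := (h.zag i).rot.swap
  have h2 := (h.zig (i + 1)).rot.rot
  have h3 := (h.zag (i + 1)).swap
  have h4 := h.xy (i + 1)
  rw [show i + 1 + 1 = i + 2 by ring] at h2 h3 h4
  exact link_ne_three (by have := hd.lt (y (i + 1)); omega) h1 h2 h3 (h.yx i) h4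

/-- The pentagons around a pentagon are surrounded by a loop of facets. -/
theorem exists_ringPair_of_cap (hd : S.FiveSix) {c : Φ} {q : ZMod 5 → Φ}
    (hq : ∀ i, S.T c (q i) (q (i + 1))) (hq2 : ∀ i, q i ≠ q (i + 2))
    (hq5 : ∀ i, S.deg (q i) = 5) :
    ∃ y, S.RingPair q y ∧ ∀ i, y i ≠ c := by
  have hy : ∀ i, ∃ d, d ≠ c ∧ S.T (q i) (q (i + 1)) d := fun i => (hq i).rot.exists_opp
  choose y hyc hy using hy
  have p₁ : ∀ i, S.T (q (i + 1)) (y i) (q i) := fun i => (hy i).rot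
  have p₂ : ∀ i, S.T (q (i + 1)) (q i) c := fun i => (hq i).rot.swap
  have p₃ : ∀ i, S.T (q (i + 1)) c (q (i + 2)) := fun i => by
    have := (hq (i + 1)).swap
    rwa [show i + 1 + 1 = i + 2 by ring] at this
  have p₄ : ∀ i, S.T (q (i + 1)) (q (i + 2)) (y (i + 1)) := fun i => by
    have := hy (i + 1)
    rwa [show i + 1 + 1 = i + 2 by ring] at this
  have hl' : ∀ a, 3 < S.deg a := fun a => by have := hd.lt a; omega
  refine ⟨y, ⟨hy, fun i => ?_, fun i => ?_, fun i => ?_⟩, hyc⟩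
  -- The neighbours of the pentagon `q (i + 1)` are `y i`, `q i`, `c`, `q (i + 2)`, `y (i + 1)`, and
  -- the last is next to the first.
  · exact (link_five (hq5 _) (p₁ i) (p₂ i) (p₃ i) (p₄ i) (hyc i) (hq2 i) (hyc _).symm).flip
  · exact link_ne_three (hl' _) (p₁ i) (p₂ i) (p₃ i) (hyc i) (hq2 i)
  · exact link_ne_three (hl' _) (p₂ i) (p₃ i) (p₄ i) (hq2 i) (hyc _).symm

variable (S) in
/-- The loops `R 0, …, R (n + 1)` surround one another, those in between consist of hexagons. -/
structure RingChain (n : ℕ) (R : ℕ → ZMod 5 → Φ) : Prop where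
  pair : ∀ j ≤ n, S.RingPair (R j) (R (j + 1))
  ne : ∀ j < n, ∀ i, R (j + 2) i ≠ R j (i + 1)
  hex : ∀ j < n, ∀ i, S.deg (R (j + 1) i) = 6

/-- By pigeonhole a long chain repeats a pair of consecutive rings. A pair determines the ring
before it, so the repetition moves back to index `0`, where a ring of pentagons meets a ring of
hexagons. -/
theorem RingChain.lt_card {n : ℕ} {R : ℕ → ZMod 5 → Φ} (h : S.RingChain n R)
    (h0 : ∀ i, S.deg (R 0 i) = 5) : n < Fintype.card ((ZMod 5 → Φ) × (ZMod 5 → Φ)) := by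
  by_contra hn
  obtain ⟨j, j', hne, he⟩ := Fintype.exists_ne_map_eq_of_card_lt
    (fun j : Fin (n + 1) => (R j, R (j + 1))) (by rw [Fintype.card_fin]; omega)
  have key : ∀ d j, 0 < d → j + d ≤ n → R j = R (j + d) → R (j + 1) = R (j + d + 1) → False := by
    intro d j hd
    induction j with
    | zero =>
      intro hn h1 h2
      have h3 := h.hex (d - 1) (by omega) 0
      rw [show d - 1 + 1 = 0 + d by omega, ← h1, h0] at h3
      omega
    | succ j ih =>
      intro hn h1 h2
      refine ih (by omega) ?_ (by rw [h1]; congr 1; omega)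
      -- `R j (i + 1)` is the facet across the edge of `R (j + 1) i` and `R (j + 1) (i + 1)`
      -- opposite to `R (j + 2) i`, hence determined by the next two rings.
      have key' : ∀ i, R j (i + 1) = R (j + d) (i + 1) := by
        intro i
        have e1 : R (j + 1) = R (j + d + 1) := by rw [h1]; congr 1; omega
        have e2 : R (j + 2) = R (j + d + 2) := by
          rw [show j + 2 = j + 1 + 1 by omega, h2]; congr 1; omega
        have t1 := ((h.pair (j + 1) (by omega)).zig i)
        have t2 := ((h.pair j (by omega)).zag i).rot
        have t3 := ((h.pair (j + d) (by omega)).zag i).rot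
        have n2 := (h.ne (j + d) (by omega) i).symm
        rw [← e1] at t3
        rw [← e2] at n2
        exact t1.uniq t2 t3 (h.ne j (by omega) i).symm n2
      funext i
      simpa using key' (i - 1)
  simp only [Prod.mk.injEq] at he
  rcases lt_or_gt_of_ne (fun e => hne (Fin.ext e)) with hlt | hlt
  · have e : (j : ℕ) + (j' - j) = j' := by omega
    exact key (j' - j) j (by omega) (by omega) (by rw [e]; exact he.1) (by rw [e]; exact he.2)
  · have e : (j' : ℕ) + (j - j') = j := by omega
    exact key (j - j') j' (by omega) (by omega) (by rw [e]; exact he.1.symm)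
      (by rw [e]; exact he.2.symm)

/-- If no ring closed up, `RingPair.next` would extend the chain to every length, against
`RingChain.lt_card`. -/
theorem exists_closed_ringChain (hd : S.FiveSix) {x y : ZMod 5 → Φ} (h : S.RingPair x y)
    (hx : ∀ i, S.deg (x i) = 5) : ∃ k R b, S.RingChain k R ∧ R 0 = x ∧ R 1 = y ∧
      (∀ i, S.deg (R (k + 1) i) = 5) ∧ (∀ i, S.T (R (k + 1) i) (R (k + 1) (i + 1)) b) ∧
      ∀ i, b ≠ R k i := by
  by_contra hno
  have key : ∀ n, ∃ R, S.RingChain n R ∧ R 0 = x ∧ R 1 = y := by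
    intro n
    induction n with
    | zero =>
      refine ⟨fun j => if j = 0 then x else y, ⟨?_, by simp, by simp⟩, by simp, by simp⟩
      intro j hj
      obtain rfl : j = 0 := by omega
      simpa using h
    | succ n ih =>
      obtain ⟨R, hR, hR0, hR1⟩ := ih
      obtain ⟨w, hw, hwx, ⟨h6, hp⟩ | ⟨h5, he⟩⟩ := (hR.pair n le_rfl).next hd
      · have hu : ∀ j ≤ n + 1, Function.update R (n + 2) w j = R j := fun j hj =>
          Function.update_of_ne (by omega) _ _
        refine ⟨Function.update R (n + 2) w, ⟨?_, ?_, ?_⟩, by rw [hu _ (by omega), hR0],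
          by rw [hu _ (by omega), hR1]⟩
        · intro j hj
          rcases hj.lt_or_eq with hlt | rfl
          · rw [hu _ (by omega), hu _ (by omega)]
            exact hR.pair j (by omega)
          · rw [hu _ (by omega), Function.update_self]
            exact hp
        · intro j hj
          rcases (Nat.le_of_lt_succ hj).lt_or_eq with hlt | rfl
          · rw [hu _ (by omega), hu _ (by omega)]
            exact hR.ne j (by omega)
          · rw [Function.update_self, hu j (by omega)]
            exact hwx
        · intro j hj
          rw [hu _ (by omega)]
          rcases (Nat.le_of_lt_succ hj).lt_or_eq with hlt | rfl
          · exact hR.hex j hlt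
          · exact h6
      · refine absurd ⟨n, R, w 0, hR, hR0, hR1, h5, fun i => he i ▸ hw i, fun i => ?_⟩ hno
        have := hwx (i - 1)
        rwa [he, sub_add_cancel] at this
  obtain ⟨R, hR, hR0, -⟩ := key (Fintype.card ((ZMod 5 → Φ) × (ZMod 5 → Φ)))
  exact absurd (hR.lt_card (by rwa [hR0])) (lt_irrefl _)

/-- A cyclic enumeration of the neighbours of a pentagon. -/
theorem exists_link_five {c : Φ} (hc : S.deg c = 5) : ∃ q : ZMod 5 → Φ,
    (∀ i, S.T c (q i) (q (i + 1))) ∧ (∀ i, q i ≠ q (i + 2)) ∧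
    ∀ v b, c ∈ S.N v → b ∈ S.N v → b ≠ c → ∃ i, b = q i := by
  obtain ⟨v, hv⟩ : (Finset.univ.filter (fun v => c ∈ S.N v)).Nonempty := by
    rw [← Finset.card_pos]; unfold deg at hc; omega
  obtain ⟨x, y, hxy⟩ := exists_T_of_mem (Finset.mem_filter.1 hv).2
  obtain ⟨b, hb, -, -⟩ := T.exists_linkSeq (S := S) (a := c) ⟨v, hxy⟩
  have hper : Function.Periodic b 5 := fun i => by have := hb.period.1 i; rwa [hc] at this
  have hz : ∀ i : ℕ, b (ZMod.val (i : ZMod 5)) = b i := fun i => by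
    rw [ZMod.val_natCast]; exact hper.map_mod_nat i
  have h1 : ∀ i : ZMod 5, b (ZMod.val (i + 1)) = b (i.val + 1) := fun i => by
    rw [← hz (i.val + 1)]; simp
  have h2 : ∀ i : ZMod 5, b (ZMod.val (i + 2)) = b (i.val + 2) := fun i => by
    rw [← hz (i.val + 2)]; simp
  refine ⟨fun i => b i.val, fun i => ?_, fun i => ?_, ?_⟩
  · dsimp only
    rw [h1]; exact (hb _).1
  · dsimp only
    rw [h2]; exact (hb _).2
  · intro u d hcu hdu hdc
    obtain ⟨e, he⟩ := exists_T_of_mem_pair hcu hdu hdc.symm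
    have hQ := link_induction (S := S) (a := c)
      (fun x y => ∃ i, (x = b i ∧ y = b (i + 1)) ∨ (y = b i ∧ x = b (i + 1)))
      (fun x y ⟨i, h⟩ => ⟨i, h.symm⟩) (hb 0).1 ⟨0, Or.inl ⟨rfl, rfl⟩⟩ ?_ ⟨u, he⟩
    · obtain ⟨i, h | h⟩ := hQ
      · exact ⟨(i : ZMod 5), by dsimp only; rw [hz]; exact h.1⟩
      · exact ⟨((i + 1 : ℕ) : ZMod 5), by dsimp only; rw [hz]; exact h.2⟩
    · rintro x y z h1 h2 ⟨i, ⟨rfl, rfl⟩ | ⟨rfl, rfl⟩⟩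
      · by_cases hz : b i = z
        · exact ⟨i, Or.inr ⟨hz.symm, rfl⟩⟩
        · exact ⟨i + 1, Or.inl ⟨rfl, (hb.succ_eq rfl rfl h2 hz).symm⟩⟩
      · by_cases hz : z = b (i + 1)
        · exact ⟨i, Or.inl ⟨rfl, hz⟩⟩
        · refine ⟨i + 4, Or.inr ⟨?_, (hper i).symm⟩⟩
          have h5 := (hb (i + 4)).1
          have h6 := (hb (i + 4)).2
          rw [show i + 4 + 1 = i + 5 by omega, hper] at h5
          rw [show i + 4 + 2 = i + 1 + 5 by omega, hper] at h6
          exact (hb i).1.uniq h2 h5.flip hz h6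

end CubicSphere

/-! ### Coverings of a cubic sphere -/

namespace CubicSphere

variable {V Φ : Type*} [Fintype V] [Fintype Φ] [DecidableEq Φ] {S : CubicSphere V Φ}

/-- This turns the steps of `connected`, which only ask for two common facets, into moves along an
edge. -/
theorem eq_or_adj {u v : V} (h : 2 ≤ (S.N u ∩ S.N v).card) :
    u = v ∨ ∃ a ∈ S.N u, a ∉ S.N v ∧ ∀ b ∈ S.N u, b ≠ a → b ∈ S.N v := by
  by_cases hs : S.N u ⊆ S.N v
  · left
    refine S.N_injective (Finset.eq_of_subset_of_card_le hs ?_)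
    rw [S.card_N, S.card_N]
  · right
    obtain ⟨a, ha, hav⟩ := Finset.not_subset.1 hs
    refine ⟨a, ha, hav, fun b hb hba => ?_⟩
    by_contra hbv
    have h1 : S.N u ∩ S.N v ⊆ ((S.N u).erase a).erase b := by
      intro x hx
      rw [Finset.mem_inter] at hx
      rw [Finset.mem_erase, Finset.mem_erase]
      exact ⟨fun e => hbv (e ▸ hx.2), fun e => hav (e ▸ hx.2), hx.1⟩
    have h2 := Finset.card_le_card h1
    rw [Finset.card_erase_of_mem (Finset.mem_erase.2 ⟨hba, hb⟩), Finset.card_erase_of_mem ha,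
      S.card_N] at h2
    omega

variable (S) in
/-- A covering of the sphere `S` by a cubic map with vertices `U` and facets `Ψ`: `fct u` lists the
facets at `u`; the edge that leaves `fct u t` leads to `(nbr u t).1`, whose facet number
`(nbr u t).2` does not contain that edge. -/
structure IsCover {U Ψ : Type*} (fct : U → Fin 3 → Ψ) (nbr : U → Fin 3 → U × Fin 3) (g : Ψ → Φ)
    (h : U → V) : Prop where
  map_N : ∀ u, S.N (h u) = Finset.univ.image (fun t => g (fct u t))
  invol : ∀ u t, nbr (nbr u t).1 (nbr u t).2 = (u, t)
  keep : ∀ u t s, s ≠ t → ∃ s', s' ≠ (nbr u t).2 ∧ fct (nbr u t).1 s' = fct u s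
  ne : ∀ u t, g (fct u t) ≠ g (fct (nbr u t).1 (nbr u t).2)

namespace IsCover

variable {U Ψ : Type*} {fct : U → Fin 3 → Ψ} {nbr : U → Fin 3 → U × Fin 3} {g : Ψ → Φ} {h : U → V}

theorem mem (H : S.IsCover fct nbr g h) (u : U) (t : Fin 3) : g (fct u t) ∈ S.N (h u) := by
  rw [H.map_N]; exact Finset.mem_image_of_mem _ (Finset.mem_univ t)

theorem exists_of_mem (H : S.IsCover fct nbr g h) {u : U} {a : Φ} (ha : a ∈ S.N (h u)) :
    ∃ t, g (fct u t) = a := by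
  rw [H.map_N] at ha
  simpa using ha

theorem injective (H : S.IsCover fct nbr g h) (u : U) :
    Function.Injective (fun t => g (fct u t)) := by
  have := S.card_N (h u)
  rw [H.map_N] at this
  have h1 := Finset.injOn_of_card_image_eq (s := Finset.univ) (f := fun t => g (fct u t))
    (by rw [this]; rfl)
  intro a b hab
  exact h1 (by simp) (by simp) hab

theorem subset (H : S.IsCover fct nbr g h) (u : U) (t : Fin 3) :
    ∀ b ∈ S.N (h u), b ≠ g (fct u t) → b ∈ S.N (h (nbr u t).1) := by
  intro b hb hne
  obtain ⟨s, rfl⟩ := H.exists_of_mem hb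
  obtain ⟨s', -, hs'⟩ := H.keep u t s (by rintro rfl; exact hne rfl)
  rw [← hs']
  exact H.mem _ _

/-- The three facets at the new vertex are the two kept ones, different from the one left by
injectivity at `u`, and a third that differs from it by `ne`. -/
theorem notMem (H : S.IsCover fct nbr g h) (u : U) (t : Fin 3) :
    g (fct u t) ∉ S.N (h (nbr u t).1) := by
  intro hm
  obtain ⟨r, hr⟩ := H.exists_of_mem hm
  have hrt : r ≠ (nbr u t).2 := by rintro rfl; exact H.ne u t hr.symm
  obtain ⟨s₁, s₂, h12, h1, h2⟩ :=
    (by decide : ∀ t : Fin 3, ∃ s₁ s₂ : Fin 3, s₁ ≠ s₂ ∧ s₁ ≠ t ∧ s₂ ≠ t) t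
  obtain ⟨r₁, hr₁, e₁⟩ := H.keep u t s₁ h1
  obtain ⟨r₂, hr₂, e₂⟩ := H.keep u t s₂ h2
  have hr12 : r₁ ≠ r₂ := by
    rintro rfl
    exact h12 (H.injective u (by simp only [← e₁, ← e₂]))
  have : r = r₁ ∨ r = r₂ := by
    exact (by decide : ∀ x r r₁ r₂ : Fin 3, r ≠ x → r₁ ≠ x → r₂ ≠ x → r₁ ≠ r₂ → r = r₁ ∨ r = r₂)
      _ _ _ _ hrt hr₁ hr₂ hr12
  rcases this with rfl | rfl
  · exact h1 (H.injective u (by simp only [← e₁, hr]))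
  · exact h2 (H.injective u (by simp only [← e₂, hr]))

theorem nbr_eq (H : S.IsCover fct nbr g h) {u : U} {t : Fin 3} {v : V}
    (hv : g (fct u t) ∉ S.N v) (hs : ∀ b ∈ S.N (h u), b ≠ g (fct u t) → b ∈ S.N v) :
    h (nbr u t).1 = v :=
  S.nbr_unique (h u) _ _ (g (fct u t)) (H.mem u t) (fun e => H.notMem u t (e ▸ H.mem u t))
    (fun e => hv (e ▸ H.mem u t)) (H.subset u t) hs

theorem surjective [Nonempty U] (H : S.IsCover fct nbr g h) : Function.Surjective h := by
  intro w
  obtain ⟨u₀⟩ := ‹Nonempty U›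
  refine S.connected (h u₀) w (fun v => ∃ u, h u = v) ⟨u₀, rfl⟩ ?_
  rintro _ v ⟨u, rfl⟩ - - hcard
  rcases eq_or_adj hcard with rfl | ⟨a, ha, hav, hb⟩
  · exact ⟨u, rfl⟩
  · obtain ⟨t, rfl⟩ := H.exists_of_mem ha
    exact ⟨_, H.nbr_eq hav hb⟩

/-- The number of sheets is constant: two preimages of a vertex lead along lifts of an edge to two
preimages of its other end, and `invol` recovers the former from the latter. So one fibre with a
single point suffices. -/
theorem bijective (H : S.IsCover fct nbr g h) (u₀ : U) (hu₀ : ∀ u, h u = h u₀ → u = u₀) :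
    Function.Bijective h := by
  have : Nonempty U := ⟨u₀⟩
  refine ⟨?_, H.surjective⟩
  suffices key : ∀ w, ∀ u u', h u = w → h u' = w → u = u' from
    fun u u' e => key (h u') u u' e rfl
  intro w
  refine S.connected (h u₀) w (fun w => ∀ u u', h u = w → h u' = w → u = u')
    (fun u u' e e' => (hu₀ u e).trans (hu₀ u' e').symm) ?_
  intro v v' hv _ _ hcard u u' hu hu'
  rcases eq_or_adj (by rwa [Finset.inter_comm] at hcard) with rfl | ⟨a, ha, hav, hb⟩
  · exact hv u u' hu hu'
  obtain ⟨t, ht⟩ := H.exists_of_mem (u := u) (hu ▸ ha)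
  obtain ⟨t', ht'⟩ := H.exists_of_mem (u := u') (hu' ▸ ha)
  have e : h (nbr u t).1 = v := H.nbr_eq (ht ▸ hav) (by rw [ht, hu]; exact hb)
  have e' : h (nbr u' t').1 = v := H.nbr_eq (ht' ▸ hav) (by rw [ht', hu']; exact hb)
  have h1 := hv _ _ e e'
  have i1 := H.invol u t
  have i2 := H.invol u' t'
  -- Both indices name a facet at `v` that is absent at `v'`; since `v` and `v'` share two facets,
  -- there is only one such facet.
  have h2 : (nbr u t).2 = (nbr u' t').2 := by
    by_contra hne
    have m1 := H.notMem (nbr u t).1 (nbr u t).2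
    have m2 := H.notMem (nbr u' t').1 (nbr u' t').2
    rw [i1, hu] at m1
    rw [i2, hu', ← h1] at m2
    have hn : g (fct (nbr u t).1 (nbr u t).2) ≠ g (fct (nbr u t).1 (nbr u' t').2) :=
      fun e => hne (H.injective _ e)
    have hsub : S.N v ∩ S.N v' ⊆ ((S.N v).erase (g (fct (nbr u t).1 (nbr u t).2))).erase
        (g (fct (nbr u t).1 (nbr u' t').2)) := by
      intro x hx
      rw [Finset.mem_inter] at hx
      rw [Finset.mem_erase, Finset.mem_erase]
      exact ⟨fun e => m2 (e ▸ hx.2), fun e => m1 (e ▸ hx.2), hx.1⟩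
    have hc := Finset.card_le_card hsub
    rw [Finset.card_erase_of_mem (Finset.mem_erase.2 ⟨hn.symm, e ▸ H.mem _ _⟩),
      Finset.card_erase_of_mem (e ▸ H.mem _ _), S.card_N] at hc
    omega
  have := i1.symm.trans ((by rw [h1, h2]) : _ = nbr (nbr u' t').1 (nbr u' t').2) |>.trans i2
  exact congrArg Prod.fst this

/-- A path inside the facet `g A`, starting at the image of a vertex of `A`, lifts edge by edge to a
path inside `A`. Injectivity of `h` identifies the end of the lift with `u`. -/
theorem mem_iff (H : S.IsCover fct nbr g h) (hinj : Function.Injective h)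
    (hex : ∀ A, ∃ u t, fct u t = A) (u : U) (A : Ψ) : g A ∈ S.N (h u) ↔ ∃ t, fct u t = A := by
  constructor
  · intro hA
    obtain ⟨u₀, t₀, h₀⟩ := hex A
    have hA₀ : g A ∈ S.N (h u₀) := h₀ ▸ H.mem u₀ t₀
    obtain ⟨u', hu', ht'⟩ := S.connected (h u₀) (h u) (fun w => ∃ u, h u = w ∧ ∃ t, fct u t = A)
      ⟨u₀, rfl, t₀, h₀⟩ (by
        rintro _ v ⟨u, rfl, t, rfl⟩ - hsub hcard
        rcases eq_or_adj hcard with rfl | ⟨a, ha, hav, hb⟩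
        · exact ⟨u, rfl, t, rfl⟩
        · obtain ⟨s, rfl⟩ := H.exists_of_mem ha
          have hts : t ≠ s := by
            rintro rfl
            exact hav (hsub (Finset.mem_inter.2 ⟨hA₀, hA⟩))
          obtain ⟨r, -, hr⟩ := H.keep u s t hts
          exact ⟨_, H.nbr_eq hav hb, r, hr⟩)
    rwa [hinj hu'] at ht'
  · rintro ⟨t, rfl⟩
    exact H.mem u t

end IsCover

/-! ### Twelve pentagons -/

theorem sum_deg : ∑ a, S.deg a = 3 * Fintype.card V := by
  have h := Finset.sum_card_bipartiteAbove_eq_sum_card_bipartiteBelow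
    (s := (Finset.univ : Finset Φ)) (t := (Finset.univ : Finset V)) (fun a v => a ∈ S.N v)
  have h1 : ∀ v, (Finset.univ.bipartiteBelow (fun a v => a ∈ S.N v) v).card = 3 := by
    intro v
    rw [← S.card_N v]
    congr 1
    ext; simp [Finset.bipartiteBelow]
  simp only [h1, Finset.sum_const, Finset.card_univ, smul_eq_mul] at h
  rw [mul_comm, ← h]
  rfl

/-- The degrees sum to `3 V = 6 Φ - 12` by Euler's formula, and each pentagon falls short of six by
one. -/
theorem card_pentagons (hd : S.FiveSix) :
    (Finset.univ.filter (fun a => S.deg a = 5)).card = 12 := by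
  have h1 := sum_deg (S := S)
  have h2 := S.euler
  have h3 : ∀ a, S.deg a + (if S.deg a = 5 then 1 else 0) = 6 := by
    intro a
    rcases hd a with h | h <;> simp [h]
  have h4 : ∑ a, (S.deg a + (if S.deg a = 5 then 1 else 0)) = 6 * Fintype.card Φ := by
    simp [h3, mul_comm]
  rw [Finset.sum_add_distrib, h1, ← Finset.card_filter] at h4
  omega

end CubicSphere

/-! ### The map from `D k` to a fullerene with a cap -/

/-- The three facets at a vertex of `D k`. -/
def DVertex.fct {k : ℕ} : DVertex k → Fin 3 → DFacet k
  | .top i => ![.top, .ring 0 i, .ring 0 (i + 1)]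
  | .zig j i => ![.ring j.castSucc i, .ring j.castSucc (i + 1), .ring j.succ i]
  | .zag j i => ![.ring j.castSucc (i + 1), .ring j.succ i, .ring j.succ (i + 1)]
  | .bottom i => ![.ring (Fin.last (k + 1)) i, .ring (Fin.last (k + 1)) (i + 1), .bottom]

theorem DVertex.mem_facets_iff {k : ℕ} (u : DVertex k) (A : DFacet k) :
    A ∈ u.facets ↔ ∃ t, u.fct t = A := by
  cases u <;> simp [DVertex.facets, DVertex.fct, Fin.exists_fin_succ, eq_comm]

/-- The end of the edge that leaves the facet `u.fct t` at `u`, with the facet that the edge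
meets there. -/
def DVertex.nbr {k : ℕ} : DVertex k → Fin 3 → DVertex k × Fin 3
  | .top i => ![(.zig 0 i, 2), (.top (i + 1), 2), (.top (i - 1), 1)]
  | .zig j i => ![(.zag j i, 2), (.zag j (i - 1), 1),
      Fin.cases (.top i, 0) (fun j' => (.zag j'.castSucc i, 0)) j]
  | .zag j i => ![Fin.lastCases (.bottom i, 2) (fun j' => (.zig j'.succ i, 2)) j,
      (.zig j (i + 1), 1), (.zig j i, 0)]
  | .bottom i => ![(.bottom (i + 1), 1), (.bottom (i - 1), 0), (.zag (Fin.last k) i, 0)]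

theorem DVertex.nbr_nbr {k : ℕ} (u : DVertex k) (t : Fin 3) :
    DVertex.nbr (u.nbr t).1 (u.nbr t).2 = (u, t) := by
  cases u with
  | top i => fin_cases t <;> simp [DVertex.nbr]
  | zig j i =>
    fin_cases t
    · simp [DVertex.nbr]
    · simp [DVertex.nbr]
    · induction j using Fin.cases <;> simp [DVertex.nbr]
  | zag j i =>
    fin_cases t
    · induction j using Fin.lastCases <;> simp [DVertex.nbr]
    · simp [DVertex.nbr]
    · simp [DVertex.nbr]
  | bottom i => fin_cases t <;> simp [DVertex.nbr]

theorem DVertex.nbr_keep {k : ℕ} (u : DVertex k) (t s : Fin 3) (hs : s ≠ t) :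
    ∃ s', s' ≠ (u.nbr t).2 ∧ DVertex.fct (u.nbr t).1 s' = u.fct s := by
  cases u with
  | top i => fin_cases t <;> fin_cases s <;> simp [DVertex.nbr, DVertex.fct, Fin.exists_fin_succ] at hs ⊢
  | zig j i =>
    fin_cases t
    · fin_cases s <;> simp [DVertex.nbr, DVertex.fct, Fin.exists_fin_succ] at hs ⊢
    · fin_cases s <;> simp [DVertex.nbr, DVertex.fct, Fin.exists_fin_succ] at hs ⊢
    · induction j using Fin.cases <;> fin_cases s <;>
        simp [DVertex.nbr, DVertex.fct, Fin.exists_fin_succ] at hs ⊢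
  | zag j i =>
    fin_cases t
    · induction j using Fin.lastCases <;> fin_cases s <;>
        simp [DVertex.nbr, DVertex.fct, Fin.exists_fin_succ] at hs ⊢
    · fin_cases s <;> simp [DVertex.nbr, DVertex.fct, Fin.exists_fin_succ] at hs ⊢
    · fin_cases s <;> simp [DVertex.nbr, DVertex.fct, Fin.exists_fin_succ] at hs ⊢
  | bottom i => fin_cases t <;> fin_cases s <;> simp [DVertex.nbr, DVertex.fct, Fin.exists_fin_succ] at hs ⊢

namespace CubicSphere

variable {V Φ : Type*} [Fintype V] [Fintype Φ] [DecidableEq Φ] {S : CubicSphere V Φ}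

/-- The facets of `D k` named by the end facets `c`, `b` and the rings `R j`. -/
def ofRings (k : ℕ) (c b : Φ) (R : ℕ → ZMod 5 → Φ) : DFacet k → Φ
  | .top => c
  | .ring j i => R j i
  | .bottom => b

/-- The end facets of `D k` and the rings around them. -/
def endFacet (k : ℕ) : Bool × Option (ZMod 5) → DFacet k
  | (true, none) => .top
  | (true, some i) => .ring 0 i
  | (false, none) => .bottom
  | (false, some i) => .ring (Fin.last (k + 1)) i

/-- The closed chain of rings defines a covering by `D k`. The twelve pentagons force the twelve end
facets to have different images, so the vertex `.top 0` is alone in its fibre and the covering is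
bijective on vertices. -/
theorem exists_ring_cover (hd : S.FiveSix) {c : Φ} (hc : S.deg c = 5)
    (hcap : ∀ v b, c ∈ S.N v → b ∈ S.N v → b ≠ c → S.deg b = 5) :
    ∃ (k : ℕ) (g : DFacet k → Φ) (h : DVertex k → V), Function.Surjective g ∧
      Function.Bijective h ∧ ∀ u A, g A ∈ S.N (h u) ↔ A ∈ u.facets := by
  obtain ⟨q, hq, hq2, -⟩ := exists_link_five hc
  have hq5 : ∀ i, S.deg (q i) = 5 := by
    intro i
    have hne := (hq i).ne.1
    obtain ⟨v, hv⟩ := hq i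
    exact hcap v (q i) (by simp [hv]) (by simp [hv]) hne.symm
  obtain ⟨y, hy, hyc⟩ := exists_ringPair_of_cap hd hq hq2 hq5
  obtain ⟨k, R, b, hR, rfl, rfl, hlast, hb, hbk⟩ := exists_closed_ringChain hd hy hq5
  have hzz : ∀ i, R (k + 1) i ≠ R (k + 1) (i + 2) := (hR.pair k le_rfl).zz hd
  have hb5 : S.deg b = 5 := by
    refine (hd b).resolve_right fun h6 => ?_
    have t : ∀ i, S.T b (R (k + 1) i) (R (k + 1) (i + 1)) := fun i => (hb i).rot.rot
    exact link_ne_five (by omega) (t 0) (t 1) (t 2) (t 3) (t 4) (hzz 0) (hzz 1) (hzz 2) (hzz 3) rfl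
  let g := ofRings k c b R
  have hT : ∀ u : DVertex k, S.T (g (u.fct 0)) (g (u.fct 1)) (g (u.fct 2)) := by
    rintro (i | ⟨j, i⟩ | ⟨j, i⟩ | i)
    · exact hq i
    · simpa [g, ofRings, DVertex.fct] using (hR.pair j (by omega)).zig i
    · simpa [g, ofRings, DVertex.fct] using (hR.pair j (by omega)).zag i
    · exact hb i
  have hex : ∀ u : DVertex k, ∃ v, S.N v = Finset.univ.image (fun t => g (u.fct t)) := by
    intro u
    obtain ⟨v, hv⟩ := hT u
    refine ⟨v, hv.trans ?_⟩
    ext x; simp [Fin.exists_fin_succ, eq_comm]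
  choose h hh using hex
  have H : S.IsCover DVertex.fct DVertex.nbr g h := by
    refine ⟨hh, DVertex.nbr_nbr, DVertex.nbr_keep, ?_⟩
    have m2 : ∀ i : ZMod 5, i - 1 + 2 = i + 1 := fun i => by ring
    have hzl : ∀ x : ZMod 5 → Φ, (∀ i, x i ≠ x (i + 2)) → ∀ i, x (i + 1) ≠ x (i - 1) := by
      intro x hx i
      have := (hx (i - 1)).symm
      rwa [m2] at this
    rintro (i | ⟨j, i⟩ | ⟨j, i⟩ | i) t
    · fin_cases t
      · exact (hyc i).symm
      · have := hq2 i
        simpa [g, ofRings, DVertex.fct, DVertex.nbr, add_assoc, one_add_one_eq_two] using this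
      · have := hzl _ hq2 i
        simpa [g, ofRings, DVertex.fct, DVertex.nbr] using this
    · have hp := hR.pair j (by omega)
      fin_cases t
      · simpa [g, ofRings, DVertex.fct, DVertex.nbr] using hp.xy i
      · have := (hp.yx (i - 1)).symm
        rw [m2] at this
        simpa [g, ofRings, DVertex.fct, DVertex.nbr] using this
      · induction j using Fin.cases with
        | zero => exact hyc i
        | succ j => simpa [g, ofRings, DVertex.fct, DVertex.nbr] using hR.ne j (by omega) i
    · have hp := hR.pair j (by omega)
      fin_cases t
      · induction j using Fin.lastCases with
        | last => simpa [g, ofRings, DVertex.fct, DVertex.nbr] using (hbk (i + 1)).symm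
        | cast j => simpa [g, ofRings, DVertex.fct, DVertex.nbr] using (hR.ne j (by omega) i).symm
      · have := hp.yx i
        simpa [g, ofRings, DVertex.fct, DVertex.nbr, add_assoc, one_add_one_eq_two] using this
      · simpa [g, ofRings, DVertex.fct, DVertex.nbr] using (hp.xy i).symm
    · fin_cases t
      · have := hzz i
        simpa [g, ofRings, DVertex.fct, DVertex.nbr, add_assoc, one_add_one_eq_two] using this
      · have := hzl _ hzz i
        simpa [g, ofRings, DVertex.fct, DVertex.nbr] using this
      · simpa [g, ofRings, DVertex.fct, DVertex.nbr] using hbk (i + 1)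
  have : Nonempty (DVertex k) := ⟨.top 0⟩
  have gsurj : Function.Surjective g := by
    intro a
    obtain ⟨v, hv⟩ : (Finset.univ.filter (fun v => a ∈ S.N v)).Nonempty := by
      rw [← Finset.card_pos]; have := hd.lt a; unfold deg at this; omega
    obtain ⟨u, rfl⟩ := H.surjective v
    obtain ⟨t, ht⟩ := H.exists_of_mem (Finset.mem_filter.1 hv).2
    exact ⟨_, ht⟩
  -- The rings `1, …, k` are hexagons, so only end facets can map to pentagons.
  have hend : ∀ A, S.deg (g A) = 5 → ∃ x, endFacet k x = A := by
    rintro (_ | ⟨j, i⟩ | _) hA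
    · exact ⟨(true, none), rfl⟩
    · induction j using Fin.cases with
      | zero => exact ⟨(true, some i), rfl⟩
      | succ j =>
        induction j using Fin.lastCases with
        | last => exact ⟨(false, some i), rfl⟩
        | cast j =>
          have := hR.hex j (by omega) i
          simp only [g, ofRings, Fin.val_succ, Fin.val_castSucc] at hA
          omega
    · exact ⟨(false, none), rfl⟩
  -- Twelve end facets map onto a set containing all twelve pentagons.
  have hinj : Function.Injective (fun x => g (endFacet k x)) := by
    have hsub : Finset.univ.filter (fun a => S.deg a = 5) ⊆
        Finset.univ.image (fun x => g (endFacet k x)) := by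
      intro a ha
      obtain ⟨A, rfl⟩ := gsurj a
      obtain ⟨x, rfl⟩ := hend A (Finset.mem_filter.1 ha).2
      exact Finset.mem_image_of_mem _ (Finset.mem_univ _)
    have h1 := Finset.card_le_card hsub
    rw [card_pentagons hd] at h1
    have h12 : (Finset.univ : Finset (Bool × Option (ZMod 5))).card = 12 := rfl
    have h2 := Finset.injOn_of_card_image_eq (le_antisymm Finset.card_image_le (h12.trans_le h1))
    intro x x' e
    exact h2 (by simp) (by simp) e
  -- The facets at such a `u` map to three pentagons, so they are end facets and by `hinj` those at
  -- `.top 0`.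
  have huniq : ∀ u, h u = h (.top 0) → u = .top 0 := by
    intro u hu
    have h5 : ∀ t, u.fct t = endFacet k (true, none) ∨ u.fct t = endFacet k (true, some 0) ∨
        u.fct t = endFacet k (true, some 1) := by
      intro t
      have hm := H.mem u t
      rw [hu, hh] at hm
      simp only [Finset.mem_image, Finset.mem_univ, true_and, Fin.exists_fin_succ] at hm
      have hm' : g (endFacet k (true, none)) = g (u.fct t) ∨
          g (endFacet k (true, some 0)) = g (u.fct t) ∨
          g (endFacet k (true, some 1)) = g (u.fct t) := by
        simpa [DVertex.fct, endFacet] using hm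
      have hdeg : S.deg (g (u.fct t)) = 5 := by
        rcases hm' with e | e | e <;> rw [← e]
        exacts [hc, hq5 _, hq5 _]
      obtain ⟨x, hx⟩ := hend _ hdeg
      rw [← hx] at hm' ⊢
      rcases hm' with e | e | e
      · exact .inl (congrArg _ (hinj e).symm)
      · exact .inr (.inl (congrArg _ (hinj e).symm))
      · exact .inr (.inr (congrArg _ (hinj e).symm))
    rcases u with i | ⟨j, i⟩ | ⟨j, i⟩ | i
    · have h1 := h5 1
      have h2 := h5 2
      simp only [DVertex.fct, endFacet, Matrix.cons_val, DFacet.ring.injEq, reduceCtorEq,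
        false_or, true_and] at h1 h2
      have : i = 0 := (by decide : ∀ i : ZMod 5, (i = 0 ∨ i = 1) → (i + 1 = 0 ∨ i + 1 = 1) → i = 0) i h1 h2
      rw [this]
    · simpa [DVertex.fct, endFacet, Fin.succ_ne_zero] using h5 2
    · simpa [DVertex.fct, endFacet, Fin.succ_ne_zero] using h5 1
    · simpa [DVertex.fct, endFacet] using h5 2
  have hbij := H.bijective _ huniq
  refine ⟨k, g, h, gsurj, hbij, fun u A => ?_⟩
  rw [DVertex.mem_facets_iff]
  refine H.mem_iff hbij.1 ?_ u A
  rintro (_ | ⟨j, i⟩ | _)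
  · exact ⟨.top 0, 0, rfl⟩
  · induction j using Fin.cases with
    | zero => exact ⟨.top i, 1, rfl⟩
    | succ j => exact ⟨.zig j i, 2, rfl⟩
  · exact ⟨.bottom 0, 2, rfl⟩

end CubicSphere

/-! ### From incidences to faces -/

/-- A bijection of the vertices that carries facets to facets induces a combinatorial
equivalence. -/
theorem combEquiv_of_incidence {V Φ U Ψ : Type*} {F : Φ → Set V} {G : Ψ → Set U} (g : Ψ → Φ)
    (h : U → V) (hg : Function.Surjective g) (hh : Function.Bijective h)
    (hi : ∀ u A, h u ∈ F (g A) ↔ u ∈ G A) :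
    CombEquiv (facesOf Set.univ F) (facesOf Set.univ G) := by
  have hG : ∀ A, h ⁻¹' F (g A) = G A := fun A => Set.ext fun u => hi u A
  refine ⟨OrderIso.symm (RelIso.ofSurjective (OrderEmbedding.ofMapLEIff
    (fun X : facesOf Set.univ G => (⟨h '' X.1, ?_⟩ : facesOf Set.univ F)) ?_) ?_)⟩
  · obtain ⟨T, hT⟩ := X.2
    refine ⟨g '' T, ?_⟩
    rw [← Set.image_preimage_eq (Set.univ ∩ _) hh.2, hT]
    simp [Set.preimage_iInter, hG]
  · intro X Y
    exact Set.image_subset_image_iff hh.1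
  · rintro ⟨Y, T, hT⟩
    -- Every index in `T` is some `g A`, so `g ⁻¹' T` cuts out the same intersection; repeated names
    -- of a facet do no harm.
    refine ⟨⟨h ⁻¹' Y, g ⁻¹' T, ?_⟩, Subtype.ext (Set.image_preimage_eq _ hh.2)⟩
    rw [hT]
    ext u
    simp only [Set.univ_inter, Set.mem_preimage, Set.mem_iInter, ← hi]
    exact ⟨fun H A hA => H _ hA, fun H a ha => by obtain ⟨A, rfl⟩ := hg a; exact H A ha⟩

/-! ### Vertices and edges of a simple polytope -/

namespace ConvexPolytope

variable {n : ℕ} (P : ConvexPolytope n)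

/-- The value at `x` of the inequality number `i`. -/
noncomputable def slack (i : Fin P.m) (x : EuclideanSpace ℝ (Fin n)) : ℝ :=
  inner ℝ (P.a i) x + P.b i

theorem slack_add_smul (i : Fin P.m) (x d : EuclideanSpace ℝ (Fin n)) (t : ℝ) :
    P.slack i (x + t • d) = P.slack i x + t * inner ℝ (P.a i) d := by
  simp only [slack, inner_add_right, inner_smul_right]; ring

theorem inner_sub_eq (i : Fin P.m) (x y : EuclideanSpace ℝ (Fin n)) :
    inner ℝ (P.a i) (x - y) = P.slack i x - P.slack i y := by
  simp only [slack, inner_sub_right]; ring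

variable {P}

theorem mem_carrier_iff {x : EuclideanSpace ℝ (Fin n)} : x ∈ P.carrier ↔ ∀ i, 0 ≤ P.slack i x :=
  Iff.rfl

theorem mem_facet {x : EuclideanSpace ℝ (Fin n)} {i : Fin P.m} :
    x ∈ P.facet i ↔ x ∈ P.carrier ∧ P.slack i x = 0 := Iff.rfl

theorem eventually_mem_carrier {x d : EuclideanSpace ℝ (Fin n)} (hx : x ∈ P.carrier)
    (hd : ∀ i, P.slack i x = 0 → inner ℝ (P.a i) d = 0) :
    ∀ᶠ t : ℝ in nhds 0, x + t • d ∈ P.carrier := by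
  simp only [mem_carrier_iff, Filter.eventually_all]
  intro i
  rcases (mem_carrier_iff.1 hx i).eq_or_lt with h | h
  · refine Filter.Eventually.of_forall fun t => ?_
    rw [slack_add_smul, hd i h.symm, ← h]; simp
  · have hc : Continuous fun t : ℝ => P.slack i (x + t • d) := by
      simp only [slack_add_smul]; fun_prop
    have := hc.tendsto 0 |>.eventually (lt_mem_nhds (a := 0) (by simpa using h))
    exact this.mono fun t ht => ht.le

theorem IsVertex.mem_carrier {v : EuclideanSpace ℝ (Fin n)} (hv : P.IsVertex v) :
    v ∈ P.carrier := by
  obtain ⟨T, hT⟩ := hv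
  have : v ∈ ({v} : Set (EuclideanSpace ℝ (Fin n))) := rfl
  rw [hT] at this
  exact this.1

/-- Otherwise a small move along `d` would stay in the face `{v}`. -/
theorem IsVertex.eq_zero {v d : EuclideanSpace ℝ (Fin n)} (hv : P.IsVertex v)
    (hd : ∀ i, P.slack i v = 0 → inner ℝ (P.a i) d = 0) : d = 0 := by
  have hc := hv.mem_carrier
  obtain ⟨T, hT⟩ := hv
  have hvT : v ∈ ({v} : Set (EuclideanSpace ℝ (Fin n))) := rfl
  rw [hT] at hvT
  have h1 := hvT.2
  simp only [Set.mem_iInter] at h1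
  obtain ⟨ε, hε, h⟩ := Metric.eventually_nhds_iff.1 (eventually_mem_carrier hc hd)
  have hmem : v + (ε / 2) • d ∈ P.carrier := h (by simp [abs_of_pos hε]; linarith)
  have : v + (ε / 2) • d ∈ ({v} : Set (EuclideanSpace ℝ (Fin n))) := by
    rw [hT]
    refine ⟨hmem, ?_⟩
    simp only [Set.mem_iInter]
    intro i hi
    refine ⟨hmem, ?_⟩
    have h2 := (h1 i hi).2
    change P.slack i _ = 0
    rw [slack_add_smul, hd i h2, mul_zero, add_zero]
    exact h2
  simpa [hε.ne'] using this

theorem isVertex_of_forall_eq_zero {v : EuclideanSpace ℝ (Fin n)} (hv : v ∈ P.carrier)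
    (h : ∀ d, (∀ i, P.slack i v = 0 → inner ℝ (P.a i) d = 0) → d = 0) : P.IsVertex v := by
  refine ⟨{i | P.slack i v = 0}, ?_⟩
  ext x
  simp only [Set.mem_singleton_iff, Set.mem_inter_iff, Set.mem_iInter, Set.mem_ofPred_eq]
  constructor
  · rintro rfl
    exact ⟨hv, fun i hi => ⟨hv, hi⟩⟩
  · rintro ⟨-, hx⟩
    refine sub_eq_zero.1 (h _ fun i hi => ?_)
    rw [inner_sub_eq, hi, (mem_facet.1 (hx i hi)).2, sub_zero]

variable (P) in
/-- The vertices of a polytope. -/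
abbrev Vertex : Type := {v // P.IsVertex v}

variable (P) in
/-- The inequalities that are equalities at the point `v`. -/
noncomputable def tight (v : EuclideanSpace ℝ (Fin n)) : Finset (Fin P.m) :=
  Finset.univ.filter (fun i => P.slack i v = 0)

theorem mem_tight {v : EuclideanSpace ℝ (Fin n)} {i : Fin P.m} :
    i ∈ P.tight v ↔ P.slack i v = 0 := by simp [tight]

theorem IsVertex.eq_of_tight_subset {v w : EuclideanSpace ℝ (Fin n)} (hv : P.IsVertex v)
    (h : P.tight v ⊆ P.tight w) : w = v := by
  refine sub_eq_zero.1 (hv.eq_zero fun i hi => ?_)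
  rw [inner_sub_eq, hi, mem_tight.1 (h (mem_tight.2 hi)), sub_zero]

instance : Finite P.Vertex :=
  Finite.of_injective (fun v : P.Vertex => P.tight v.1) fun v _ h =>
    (Subtype.ext (v.2.eq_of_tight_subset h.subset)).symm

noncomputable instance : Fintype P.Vertex := Fintype.ofFinite _

theorem IsSimple.card_tight (hs : P.IsSimple) {v : EuclideanSpace ℝ (Fin n)}
    (hv : P.IsVertex v) : (P.tight v).card = n := by
  refine Eq.trans ?_ (hs v hv)
  rw [← Set.ncard_coe_finset]
  congr 1
  ext i
  simp [mem_tight, mem_facet, hv.mem_carrier]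

/-- The tight normals at `v` separate directions by `IsVertex.eq_zero`, and there are `n` of them;
an injective map between spaces of dimension `n` is onto. The resulting directions form the dual
basis. -/
theorem IsSimple.exists_dir (hs : P.IsSimple) {v : EuclideanSpace ℝ (Fin n)}
    (hv : P.IsVertex v) (i : Fin P.m) : ∃ d : EuclideanSpace ℝ (Fin n),
      ∀ j ∈ P.tight v, inner ℝ (P.a j) d = if j = i then 1 else 0 := by
  let f : EuclideanSpace ℝ (Fin n) →ₗ[ℝ] (P.tight v → ℝ) :=
    LinearMap.pi fun j => (innerSL ℝ (P.a j)).toLinearMap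
  have hf : Function.Injective f := by
    rw [injective_iff_map_eq_zero]
    intro d hd
    exact hv.eq_zero fun j hj => congrFun hd ⟨j, mem_tight.2 hj⟩
  have hsurj : Function.Surjective f :=
    (LinearMap.injective_iff_surjective_of_finrank_eq_finrank (by simp [hs.card_tight hv])).1 hf
  obtain ⟨d, hd⟩ := hsurj fun j => if j.1 = i then 1 else 0
  exact ⟨d, fun j hj => congrFun hd ⟨j, hj⟩⟩

open Classical in
variable (P) in
/-- At a vertex `v` of a simple polytope, the direction of the edge that leaves the facet `i`. -/
noncomputable def dir (v : EuclideanSpace ℝ (Fin n)) (i : Fin P.m) : EuclideanSpace ℝ (Fin n) :=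
  if h : ∃ d : EuclideanSpace ℝ (Fin n),
      ∀ j ∈ P.tight v, inner ℝ (P.a j) d = if j = i then 1 else 0 then h.choose else 0

theorem IsSimple.inner_dir (hs : P.IsSimple) {v : EuclideanSpace ℝ (Fin n)}
    (hv : P.IsVertex v) (i j : Fin P.m) (hj : j ∈ P.tight v) :
    inner ℝ (P.a j) (P.dir v i) = if j = i then 1 else 0 := by
  have h := hs.exists_dir hv i
  rw [dir, dif_pos h]
  exact h.choose_spec j hj

theorem IsSimple.dir_ne_zero (hs : P.IsSimple) {v : EuclideanSpace ℝ (Fin n)}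
    (hv : P.IsVertex v) {i : Fin P.m} (hi : i ∈ P.tight v) : P.dir v i ≠ 0 := by
  intro h
  have := hs.inner_dir hv i i hi
  simp [h] at this

theorem IsSimple.sub_eq_sum (hs : P.IsSimple) {v : EuclideanSpace ℝ (Fin n)}
    (hv : P.IsVertex v) (x : EuclideanSpace ℝ (Fin n)) :
    x - v = ∑ i ∈ P.tight v, P.slack i x • P.dir v i := by
  refine sub_eq_zero.1 (hv.eq_zero fun j hj => ?_)
  have hj' := mem_tight.2 hj
  rw [inner_sub_right, inner_sub_eq, hj, inner_sum]
  simp only [inner_smul_right, hs.inner_dir hv _ j hj']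
  simp [hj']

theorem IsSimple.eq_add_smul_dir (hs : P.IsSimple) {v x : EuclideanSpace ℝ (Fin n)}
    (hv : P.IsVertex v) {i : Fin P.m} (hi : i ∈ P.tight v)
    (hx : ∀ j ∈ P.tight v, j ≠ i → P.slack j x = 0) : x = v + P.slack i x • P.dir v i := by
  have h := hs.sub_eq_sum hv x
  rw [Finset.sum_eq_single i (fun j hj hji => by rw [hx j hj hji, zero_smul])
    (fun h => absurd hi h)] at h
  rw [← h]; abel

/-- Otherwise the whole ray from `x` along `d` would lie in the bounded set `P.carrier`. -/
theorem exists_inner_neg {x d : EuclideanSpace ℝ (Fin n)} (hx : x ∈ P.carrier) (hd : d ≠ 0) :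
    ∃ j, inner ℝ (P.a j) d < 0 := by
  by_contra! h
  obtain ⟨C, hC⟩ := P.bounded.exists_norm_le
  have hd' : 0 < ‖d‖ := norm_pos_iff.2 hd
  set t : ℝ := (|C| + ‖x‖ + 1) / ‖d‖ with ht
  have ht0 : 0 ≤ t := by positivity
  have hmem : x + t • d ∈ P.carrier := mem_carrier_iff.2 fun i => by
    rw [slack_add_smul]
    exact add_nonneg (mem_carrier_iff.1 hx i) (mul_nonneg ht0 (h i))
  have h1 : ‖x + t • d‖ ≤ C := hC _ hmem
  have h2 : ‖t • d‖ = |C| + ‖x‖ + 1 := by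
    rw [norm_smul, Real.norm_of_nonneg ht0, ht, div_mul_cancel₀ _ hd'.ne']
  have h3 : ‖t • d‖ ≤ ‖x + t • d‖ + ‖x‖ := by
    calc ‖t • d‖ = ‖(x + t • d) - x‖ := by rw [add_sub_cancel_left]
      _ ≤ _ := norm_sub_le _ _
  have := le_abs_self C
  linarith

/-- The second end of an edge. -/
theorem IsSimple.exists_nbr (hs : P.IsSimple) {v : EuclideanSpace ℝ (Fin n)}
    (hv : P.IsVertex v) {i : Fin P.m} (hi : i ∈ P.tight v) : ∃ t : ℝ, 0 < t ∧
      P.IsVertex (v + t • P.dir v i) ∧ i ∉ P.tight (v + t • P.dir v i) ∧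
      ∀ j ∈ P.tight v, j ≠ i → j ∈ P.tight (v + t • P.dir v i) := by
  set d := P.dir v i with hd
  obtain ⟨j₀, hj₀⟩ := exists_inner_neg hv.mem_carrier (hs.dir_ne_zero hv hi)
  have hpos : ∀ j, inner ℝ (P.a j) d < 0 → 0 < P.slack j v := by
    intro j hj
    refine (mem_carrier_iff.1 hv.mem_carrier j).lt_of_ne fun h => ?_
    rw [hd, hs.inner_dir hv i j (mem_tight.2 h.symm)] at hj
    split_ifs at hj <;> linarith
  -- The ratio test of the simplex method: `k` is the first inequality to become tight on the ray
  -- along `d`.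
  obtain ⟨k, hk, hmin⟩ := Finset.exists_min_image
    (Finset.univ.filter fun j => inner ℝ (P.a j) d < 0)
    (fun j => P.slack j v / -inner ℝ (P.a j) d) ⟨j₀, by simpa using hj₀⟩
  replace hk : inner ℝ (P.a k) d < 0 := by simpa using hk
  set t := P.slack k v / -inner ℝ (P.a k) d with ht
  have ht0 : 0 < t := div_pos (hpos k hk) (by linarith)
  have hkt : P.slack k (v + t • d) = 0 := by
    rw [slack_add_smul, ht, div_mul_eq_mul_div, div_neg, mul_div_cancel_right₀ _ hk.ne]; ring
  have hcar : v + t • d ∈ P.carrier := mem_carrier_iff.2 fun j => by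
    rw [slack_add_smul]
    rcases lt_or_ge (inner ℝ (P.a j) d) 0 with h | h
    · have h1 := hmin j (by simpa using h)
      rw [le_div_iff₀ (by linarith)] at h1
      linarith
    · exact add_nonneg (mem_carrier_iff.1 hv.mem_carrier j) (mul_nonneg ht0.le h)
  have htight : ∀ j ∈ P.tight v, j ≠ i → j ∈ P.tight (v + t • d) := by
    intro j hj hji
    rw [mem_tight, slack_add_smul, hd, hs.inner_dir hv i j hj, if_neg hji, mem_tight.1 hj]
    simp
  refine ⟨t, ht0, isVertex_of_forall_eq_zero hcar fun e he => ?_, ?_, htight⟩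
  · have h1 : v + e = v + P.slack i (v + e) • d := hs.eq_add_smul_dir hv hi fun j hj hji => by
      have h2 := he j (mem_tight.1 (htight j hj hji))
      have h3 := P.slack_add_smul j v e 1
      rwa [one_smul, h2, mul_zero, add_zero, mem_tight.1 hj] at h3
    have h2 := he k hkt
    rw [add_left_cancel h1, inner_smul_right] at h2
    rw [add_left_cancel h1, (mul_eq_zero.1 h2).resolve_right hk.ne, zero_smul]
  · rw [mem_tight, slack_add_smul, hd, hs.inner_dir hv i i hi, if_pos rfl, mem_tight.1 hi]
    simpa using ht0.ne'

theorem IsVertex.not_between {x u d : EuclideanSpace ℝ (Fin n)} (hu : P.IsVertex u)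
    (hx : x ∈ P.carrier) {c t : ℝ} (hc : 0 < c) (hct : c < t) (hd : d ≠ 0) (hxu : u = x + c • d)
    (ht : x + t • d ∈ P.carrier) : False := by
  refine hd (hu.eq_zero fun j hj => ?_)
  have h1 := mem_carrier_iff.1 hx j
  have h2 := mem_carrier_iff.1 ht j
  rw [hxu, slack_add_smul] at hj
  rw [slack_add_smul] at h2
  have h3 : 0 ≤ (t - c) * inner ℝ (P.a j) d := by linarith
  have h4 : 0 ≤ inner ℝ (P.a j) d := nonneg_of_mul_nonneg_right h3 (by linarith)
  have h5 : c * inner ℝ (P.a j) d ≤ 0 := by linarith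
  exact le_antisymm (nonpos_of_mul_nonpos_right h5 hc) h4

theorem IsSimple.nbr_unique (hs : P.IsSimple) {v w w' : EuclideanSpace ℝ (Fin n)}
    (hv : P.IsVertex v) (hw : P.IsVertex w) (hw' : P.IsVertex w') {i : Fin P.m}
    (hi : i ∈ P.tight v) (hvw : v ≠ w) (hvw' : v ≠ w')
    (h : ∀ j ∈ P.tight v, j ≠ i → j ∈ P.tight w)
    (h' : ∀ j ∈ P.tight v, j ≠ i → j ∈ P.tight w') : w = w' := by
  have e := hs.eq_add_smul_dir hv hi fun j hj hji => mem_tight.1 (h j hj hji)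
  have e' := hs.eq_add_smul_dir hv hi fun j hj hji => mem_tight.1 (h' j hj hji)
  have p : 0 < P.slack i w := (mem_carrier_iff.1 hw.mem_carrier i).lt_of_ne fun h0 =>
    hvw (by rw [e, ← h0]; simp)
  have p' : 0 < P.slack i w' := (mem_carrier_iff.1 hw'.mem_carrier i).lt_of_ne fun h0 =>
    hvw' (by rw [e', ← h0]; simp)
  have hd := hs.dir_ne_zero hv hi
  rcases lt_trichotomy (P.slack i w) (P.slack i w') with hlt | heq | hlt
  · exact (hw.not_between hv.mem_carrier p hlt hd e (e' ▸ hw'.mem_carrier)).elim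
  · rw [e, e', heq]
  · exact (hw'.not_between hv.mem_carrier p' hlt hd e' (e ▸ hw.mem_carrier)).elim

/-- By `sub_eq_sum`, `w - v` is a combination of edge directions with the slacks of `w` as
nonnegative coefficients; a term with positive value of `l` has positive slack, so its inequality is
not tight at `w`. -/
theorem IsSimple.exists_dir_pos (hs : P.IsSimple) {v w : EuclideanSpace ℝ (Fin n)}
    (hv : P.IsVertex v) (hw : w ∈ P.carrier) (l : EuclideanSpace ℝ (Fin n) →ₗ[ℝ] ℝ)
    (hl : l v < l w) : ∃ i ∈ P.tight v, i ∉ P.tight w ∧ 0 < l (P.dir v i) := by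
  have h1 : 0 < l (w - v) := by rw [map_sub]; linarith
  rw [hs.sub_eq_sum hv, map_sum] at h1
  obtain ⟨i, hi, hpos⟩ := Finset.exists_lt_of_sum_lt (f := fun _ => (0 : ℝ)) (by simpa using h1)
  have h2 := mem_carrier_iff.1 hw i
  refine ⟨i, hi, fun h => ?_, (pos_iff_pos_of_mul_pos hpos).1 (h2.lt_of_ne fun h => ?_)⟩
  · rw [mem_tight.1 h, zero_mul] at hpos; exact hpos.false
  · rw [← h, zero_mul] at hpos; exact hpos.false

theorem IsVertex.exists_functional {w : EuclideanSpace ℝ (Fin n)} (hw : P.IsVertex w) :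
    ∃ l : EuclideanSpace ℝ (Fin n) →ₗ[ℝ] ℝ, ∀ v ∈ P.carrier, v ≠ w → l v < l w := by
  refine ⟨-∑ i ∈ P.tight w, (innerSL ℝ (P.a i)).toLinearMap, fun v hv hne => ?_⟩
  have h1 : ∀ x, (∑ i ∈ P.tight w, (innerSL ℝ (P.a i)).toLinearMap) x
      = ∑ i ∈ P.tight w, (P.slack i x - P.b i) := by
    intro x; simp [slack]
  simp only [LinearMap.neg_apply, h1, neg_lt_neg_iff]
  have h0 : ∀ i ∈ P.tight w, P.slack i w = 0 := fun i hi => mem_tight.1 hi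
  refine Finset.sum_lt_sum (fun i hi => ?_) ?_
  · rw [h0 i hi]; linarith [mem_carrier_iff.1 hv i]
  · by_contra! hle
    refine hne (hw.eq_of_tight_subset fun i hi => mem_tight.2 (le_antisymm ?_ (mem_carrier_iff.1 hv i)))
    have := hle i hi
    rw [h0 i hi] at this; linarith

/-- Climb towards `w` with a functional maximal only there. An improving edge leaves a facet not
containing `w`, so the climb stays in every facet common to `v` and `w`. -/
theorem IsSimple.connected (hs : P.IsSimple) (hn : 3 ≤ n) (v w : P.Vertex) (Q : P.Vertex → Prop)
    (hQ : Q v) (step : ∀ u u', Q u → P.tight v.1 ∩ P.tight w.1 ⊆ P.tight u.1 →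
      P.tight v.1 ∩ P.tight w.1 ⊆ P.tight u'.1 → 2 ≤ (P.tight u.1 ∩ P.tight u'.1).card → Q u') :
    Q w := by
  classical
  obtain ⟨l, hl⟩ := w.2.exists_functional
  obtain ⟨u, hu, hmax⟩ := Finset.exists_max_image
    (Finset.univ.filter fun u : P.Vertex => Q u ∧ P.tight v.1 ∩ P.tight w.1 ⊆ P.tight u.1)
    (fun u => l u.1) ⟨v, by simp [hQ, Finset.inter_subset_left]⟩
  simp only [Finset.mem_filter, Finset.mem_univ, true_and] at hu hmax
  by_cases hne : u.1 = w.1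
  · rw [← Subtype.ext hne]; exact hu.1
  obtain ⟨i, hi, hiw, hpos⟩ := hs.exists_dir_pos u.2 w.2.mem_carrier l
    (hl _ u.2.mem_carrier hne)
  obtain ⟨t, ht, hvert, -, hsub⟩ := hs.exists_nbr u.2 hi
  have h1 : P.tight v.1 ∩ P.tight w.1 ⊆ P.tight (u.1 + t • P.dir u.1 i) := fun j hj =>
    hsub j (hu.2 hj) fun e => hiw (e ▸ (Finset.mem_inter.1 hj).2)
  have h2 : (P.tight u.1).erase i ⊆ P.tight u.1 ∩ P.tight (u.1 + t • P.dir u.1 i) := fun j hj =>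
    Finset.mem_inter.2 ⟨Finset.mem_of_mem_erase hj,
      hsub j (Finset.mem_of_mem_erase hj) (Finset.ne_of_mem_erase hj)⟩
  have h3 := Finset.card_le_card h2
  rw [Finset.card_erase_of_mem hi, hs.card_tight u.2] at h3
  -- An edge has at least `n - 1 ≥ 2` common facets at its ends, as `step` requires.
  have h4 := hmax ⟨_, hvert⟩ ⟨step u ⟨_, hvert⟩ hu.1 hu.2 h1 (by simp only; omega), h1⟩
  simp only [map_add, map_smul, smul_eq_mul] at h4
  have := mul_pos ht hpos
  linarith

end ConvexPolytope

/-! ### Euler's formula -/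

/-- Used with `s` the facets at a vertex and `p b` saying that the edge leaving `b` descends. Facet
`a` contains the other two edges, so the left side counts the facets of which the vertex is the
highest or the lowest point. -/
theorem card_filter_add_card_filter {m : ℕ} {s : Finset (Fin m)} (hs : s.card = 3)
    (p : Fin m → Prop) [DecidablePred p] :
    (s.filter fun a => ∀ b ∈ s, b ≠ a → p b).card + (s.filter fun a => ∀ b ∈ s, b ≠ a → ¬ p b).card =
      1 + (if ∀ b ∈ s, p b then 2 else 0) + if ∀ b ∈ s, ¬ p b then 2 else 0 := by
  obtain ⟨x, y, z, hxy, hxz, hyz, rfl⟩ := Finset.card_eq_three.1 hs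
  by_cases hx : p x <;> by_cases hy : p y <;> by_cases hz : p z <;>
    simp [Finset.filter_insert, Finset.filter_singleton, hx, hy, hz, hxy, hxz, hyz, hxy.symm,
      hxz.symm, hyz.symm]

namespace ConvexPolytope

variable {n : ℕ} {P : ConvexPolytope n}

variable (P) in
/-- A linear functional that takes different values at different vertices. -/
theorem exists_generic : ∃ l : EuclideanSpace ℝ (Fin n) →ₗ[ℝ] ℝ,
    ∀ v w : P.Vertex, l v.1 = l w.1 → v = w := by
  obtain ⟨l, hl⟩ := Module.exists_dual_forall_apply_ne_zero (K := ℝ)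
    (fun p : {p : P.Vertex × P.Vertex // p.1 ≠ p.2} => p.1.1.1 - p.1.2.1)
    (fun p h => p.2 (Subtype.ext (sub_eq_zero.1 h)))
  refine ⟨l, fun v w h => ?_⟩
  by_contra hne
  exact hl ⟨(v, w), hne⟩ (by rw [map_sub, h, sub_self])

theorem IsSimple.generic_dir_ne_zero (hs : P.IsSimple) {l : EuclideanSpace ℝ (Fin n) →ₗ[ℝ] ℝ}
    (hl : ∀ v w : P.Vertex, l v.1 = l w.1 → v = w) (v : P.Vertex) {i : Fin P.m}
    (hi : i ∈ P.tight v.1) : l (P.dir v.1 i) ≠ 0 := by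
  intro h0
  obtain ⟨t, ht, hvert, hni, -⟩ := hs.exists_nbr v.2 hi
  have := hl v ⟨_, hvert⟩ (by simp [h0])
  have h1 : v.1 = v.1 + t • P.dir v.1 i := congrArg Subtype.val this
  rw [← h1] at hni
  exact hni hi

/-- For a generic linear functional every nonempty face has exactly one highest vertex. -/
theorem IsSimple.existsUnique_top (hs : P.IsSimple) {l : EuclideanSpace ℝ (Fin n) →ₗ[ℝ] ℝ}
    (hl : ∀ v w : P.Vertex, l v.1 = l w.1 → v = w) (F : Finset (Fin P.m))
    (hF : ∃ v : P.Vertex, F ⊆ P.tight v.1) :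
    ∃! v : P.Vertex, F ⊆ P.tight v.1 ∧ ∀ i ∈ P.tight v.1, i ∉ F → l (P.dir v.1 i) < 0 := by
  classical
  obtain ⟨v₀, hv₀⟩ := hF
  obtain ⟨v, hv, hmax⟩ := Finset.exists_max_image
    (Finset.univ.filter fun u : P.Vertex => F ⊆ P.tight u.1) (fun u => l u.1) ⟨v₀, by simpa⟩
  simp only [Finset.mem_filter, Finset.mem_univ, true_and] at hv hmax
  refine ⟨v, ⟨hv, fun i hi hiF => ?_⟩, ?_⟩
  · obtain ⟨t, ht, hvert, -, hsub⟩ := hs.exists_nbr v.2 hi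
    have h1 := hmax ⟨_, hvert⟩ fun j hj => hsub j (hv hj) fun e => hiF (e ▸ hj)
    simp only [map_add, map_smul, smul_eq_mul] at h1
    refine lt_of_le_of_ne ?_ (hs.generic_dir_ne_zero hl v hi)
    by_contra! h2
    have := mul_pos ht h2
    linarith
  · rintro w ⟨hw, hdown⟩
    by_contra hne
    have hlt : l w.1 < l v.1 := (hmax w hw).lt_of_ne fun e => hne (hl _ _ e)
    obtain ⟨i, hi, hiv, hpos⟩ := hs.exists_dir_pos w.2 v.2.mem_carrier l hlt
    exact (hdown i hi fun hiF => hiv (hv hiF)).not_gt hpos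

end ConvexPolytope

namespace ConvexPolytope

variable {P : ConvexPolytope 3}

/-- Euler's formula for simple `3`-polytopes. -/
theorem IsSimple.euler (hs : P.IsSimple) (hF : ∀ i, ∃ v : P.Vertex, i ∈ P.tight v.1) (h0 : 0 < P.m) :
    Fintype.card P.Vertex + 4 = 2 * Fintype.card (Fin P.m) := by
  obtain ⟨l, hl⟩ := P.exists_generic
  have hl' : ∀ v w : P.Vertex, (-l) v.1 = (-l) w.1 → v = w := fun v w h => hl v w (neg_injective h)
  -- Double counting: each facet has one highest vertex.
  have count : ∀ l : EuclideanSpace ℝ (Fin 3) →ₗ[ℝ] ℝ,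
      (∀ v w : P.Vertex, l v.1 = l w.1 → v = w) →
      ∀ (p : P.Vertex → Fin P.m → Prop) [∀ v, DecidablePred (p v)],
      (∀ v, ∀ i ∈ P.tight v.1, p v i ↔ l (P.dir v.1 i) < 0) →
      ∑ v : P.Vertex, ((P.tight v.1).filter
        fun i => ∀ j ∈ P.tight v.1, j ≠ i → p v j).card = Fintype.card (Fin P.m) := by
    intro l hl p _ hp
    have h := Finset.sum_card_bipartiteAbove_eq_sum_card_bipartiteBelow
      (s := (Finset.univ : Finset (Fin P.m))) (t := (Finset.univ : Finset P.Vertex))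
      (fun i v => i ∈ P.tight v.1 ∧ ∀ j ∈ P.tight v.1, j ≠ i → p v j)
    have h1 : ∀ i, (Finset.univ.bipartiteAbove (fun i (v : P.Vertex) => i ∈ P.tight v.1 ∧
        ∀ j ∈ P.tight v.1, j ≠ i → p v j) i).card = 1 := by
      intro i
      obtain ⟨v, hv, huniq⟩ := hs.existsUnique_top hl {i} (by simpa using hF i)
      have hiff : ∀ w : P.Vertex, (i ∈ P.tight w.1 ∧ ∀ j ∈ P.tight w.1, j ≠ i → p w j) ↔
          ({i} ⊆ P.tight w.1 ∧ ∀ j ∈ P.tight w.1, j ∉ ({i} : Finset _) → l (P.dir w.1 j) < 0) := by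
        intro w
        rw [Finset.singleton_subset_iff]
        refine and_congr_right fun _ => forall₂_congr fun j hj => ?_
        rw [hp w j hj, Finset.mem_singleton]
      refine Finset.card_eq_one.2 ⟨v, ?_⟩
      ext w
      simp only [Finset.mem_bipartiteAbove, Finset.mem_univ, true_and, Finset.mem_singleton, hiff]
      exact ⟨fun hw => huniq w (by simpa using hw), by rintro rfl; simpa using hv⟩
    simp only [h1, Finset.sum_const, smul_eq_mul, mul_one, Finset.card_univ] at h
    rw [h]
    refine Finset.sum_congr rfl fun v _ => congrArg _ ?_
    ext i
    simp
  have one : ∀ l : EuclideanSpace ℝ (Fin 3) →ₗ[ℝ] ℝ,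
      (∀ v w : P.Vertex, l v.1 = l w.1 → v = w) →
      ∀ (p : P.Vertex → Fin P.m → Prop) [∀ v, DecidablePred (p v)],
      (∀ v, ∀ i ∈ P.tight v.1, p v i ↔ l (P.dir v.1 i) < 0) →
      ∑ v : P.Vertex, (if ∀ i ∈ P.tight v.1, p v i then 2 else 0) = 2 := by
    intro l hl p _ hp
    obtain ⟨v₀, -⟩ := hF ⟨0, h0⟩
    obtain ⟨v, hv, huniq⟩ := hs.existsUnique_top hl ∅ ⟨v₀, by simp⟩
    simp only [Finset.empty_subset, Finset.notMem_empty, not_false_eq_true, forall_const,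
      true_and] at hv huniq
    have hiff : ∀ w : P.Vertex, (∀ i ∈ P.tight w.1, p w i) ↔
        ∀ i ∈ P.tight w.1, l (P.dir w.1 i) < 0 := fun w => forall₂_congr fun j hj => hp w j hj
    rw [Finset.sum_eq_single v (fun w _ hw => if_neg fun h => hw (huniq w ((hiff w).1 h)))
      (by simp), if_pos ((hiff v).2 hv)]
  obtain ⟨p, hp⟩ : ∃ p : P.Vertex → Fin P.m → Prop, ∀ v i, p v i ↔ l (P.dir v.1 i) < 0 :=
    ⟨_, fun _ _ => Iff.rfl⟩
  have hp' : ∀ v : P.Vertex, ∀ i ∈ P.tight v.1, ¬ p v i ↔ (-l) (P.dir v.1 i) < 0 := by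
    intro v i hi
    have := hs.generic_dir_ne_zero hl v hi
    simp only [LinearMap.neg_apply, hp, not_lt, neg_lt_zero]
    exact ⟨fun h => h.lt_of_ne this.symm, le_of_lt⟩
  have := fun v => Classical.decPred (p v)
  -- Summing over the vertices gives `m + m = V + 2 + 2`: every facet has one top and one bottom,
  -- and so does the polytope.
  have hsum := Finset.sum_congr (rfl : (Finset.univ : Finset P.Vertex) = _) fun v _ =>
    card_filter_add_card_filter (hs.card_tight v.2) (p v)
  simp only [Finset.sum_add_distrib, Finset.sum_const, Finset.card_univ, smul_eq_mul,
    mul_one] at hsum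
  rw [count l hl p fun v i _ => hp v i, one l hl p fun v i _ => hp v i,
    count (-l) hl' (fun v i => ¬ p v i) hp', one (-l) hl' (fun v i => ¬ p v i) hp'] at hsum
  omega

variable (P) in
/-- The facets and vertices of a simple `3`-polytope. -/
noncomputable def toCubicSphere (hs : P.IsSimple) (hF : ∀ i, ∃ v : P.Vertex, i ∈ P.tight v.1)
    (h0 : 0 < P.m) : CubicSphere P.Vertex (Fin P.m) where
  N v := P.tight v.1
  card_N v := hs.card_tight v.2
  exists_nbr v a ha := by
    obtain ⟨t, -, hvert, hna, hsub⟩ := hs.exists_nbr v.2 ha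
    exact ⟨⟨_, hvert⟩, hna, hsub⟩
  nbr_unique v w w' a ha hvw hvw' h h' := Subtype.ext <|
    hs.nbr_unique v.2 w.2 w'.2 ha (fun e => hvw (Subtype.ext e)) (fun e => hvw' (Subtype.ext e)) h h'
  connected := hs.connected le_rfl
  euler := hs.euler hF h0

theorem isGon_iff {hs : P.IsSimple} {hF : ∀ i, ∃ v : P.Vertex, i ∈ P.tight v.1} {h0 : 0 < P.m}
    {s : ℕ} {i : Fin P.m} : P.IsGon s i ↔ (P.toCubicSphere hs hF h0).deg i = s := by
  have : {v | P.IsVertex v ∧ v ∈ P.facet i} =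
      ((Finset.univ.filter fun v : P.Vertex => i ∈ P.tight v.1).map
        ⟨Subtype.val, Subtype.val_injective⟩ : Finset (EuclideanSpace ℝ (Fin 3))) := by
    ext v
    simp only [Set.mem_ofPred_eq, Finset.coe_map, Finset.coe_filter, Finset.mem_univ, true_and,
      Function.Embedding.coeFn_mk, Set.mem_image]
    constructor
    · rintro ⟨hv, hvi⟩
      exact ⟨⟨v, hv⟩, mem_tight.2 hvi.2, rfl⟩
    · rintro ⟨v, hv, rfl⟩
      exact ⟨v.2, v.2.mem_carrier, mem_tight.1 hv⟩
  rw [IsGon, this, Set.ncard_coe_finset, Finset.card_map]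
  rfl

end ConvexPolytope

/-! ### Faces as sets of vertices -/

namespace ConvexPolytope

variable {n : ℕ} {P : ConvexPolytope n}

theorem continuous_slack (i : Fin P.m) : Continuous (P.slack i) := by
  unfold slack; fun_prop

theorem slack_combo (i : Fin P.m) (x y : EuclideanSpace ℝ (Fin n)) {s t : ℝ} (hst : s + t = 1) :
    P.slack i (s • x + t • y) = s * P.slack i x + t * P.slack i y := by
  obtain rfl : t = 1 - s := by linarith
  simp only [slack, inner_add_right, inner_smul_right]; ring

theorem isClosed_carrier : IsClosed P.carrier := by
  have : P.carrier = ⋂ i, {x | 0 ≤ P.slack i x} := by ext; simp [mem_carrier_iff]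
  rw [this]
  exact isClosed_iInter fun i => isClosed_le continuous_const (continuous_slack i)

theorem convex_carrier : Convex ℝ P.carrier := by
  intro x hx y hy s t hs ht hst
  refine mem_carrier_iff.2 fun i => ?_
  rw [slack_combo i x y hst]
  exact add_nonneg (mul_nonneg hs (mem_carrier_iff.1 hx i)) (mul_nonneg ht (mem_carrier_iff.1 hy i))

theorem isClosed_facet (i : Fin P.m) : IsClosed (P.facet i) :=
  isClosed_carrier.inter (isClosed_eq (continuous_slack i) continuous_const)

theorem convex_facet (i : Fin P.m) : Convex ℝ (P.facet i) := by
  refine convex_carrier.inter ?_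
  intro x hx y hy s t _ _ hst
  change P.slack i _ = 0
  rw [slack_combo i x y hst, show P.slack i x = 0 from hx, show P.slack i y = 0 from hy]
  simp

theorem isCompact_face {G : Set (EuclideanSpace ℝ (Fin n))} (hG : G ∈ P.faces) : IsCompact G := by
  obtain ⟨T, rfl⟩ := hG
  refine (Metric.isCompact_of_isClosed_isBounded isClosed_carrier P.bounded).inter_right ?_
  exact isClosed_biInter fun i _ => isClosed_facet i

theorem convex_face {G : Set (EuclideanSpace ℝ (Fin n))} (hG : G ∈ P.faces) : Convex ℝ G := by
  obtain ⟨T, rfl⟩ := hG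
  exact convex_carrier.inter (convex_iInter₂ fun i _ => convex_facet i)

/-- A direction along which all tight inequalities stay tight can be followed both ways inside the
face, which extremality forbids unless it is zero. -/
theorem isVertex_of_mem_extremePoints {G : Set (EuclideanSpace ℝ (Fin n))} (hG : G ∈ P.faces)
    {x : EuclideanSpace ℝ (Fin n)} (hx : x ∈ G.extremePoints ℝ) : P.IsVertex x := by
  obtain ⟨T, rfl⟩ := hG
  have hxT := hx.1.2
  simp only [Set.mem_iInter] at hxT
  refine isVertex_of_forall_eq_zero hx.1.1 fun d hd => ?_
  obtain ⟨ε, hε, h⟩ := Metric.eventually_nhds_iff.1 (eventually_mem_carrier hx.1.1 hd)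
  have hmem : ∀ t : ℝ, |t| < ε → x + t • d ∈ P.carrier ∩ ⋂ i ∈ T, P.facet i := by
    intro t ht
    have hc : x + t • d ∈ P.carrier := h (by simpa using ht)
    refine ⟨hc, ?_⟩
    simp only [Set.mem_iInter]
    refine fun i hi => mem_facet.2 ⟨hc, ?_⟩
    have h0 := (mem_facet.1 (hxT i hi)).2
    rw [slack_add_smul, hd i h0, h0]; simp
  have hε2 : |ε / 2| < ε := by rw [abs_of_pos (by linarith)]; linarith
  have h1 := hx.2 (hmem (ε / 2) hε2) (hmem (-(ε / 2)) (by rwa [abs_neg]))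
    ⟨1 / 2, 1 / 2, by norm_num, by norm_num, by norm_num, by module⟩
  simpa [hε.ne'] using h1

theorem exists_vertex_mem_face {G : Set (EuclideanSpace ℝ (Fin n))} (hG : G ∈ P.faces)
    (hne : G.Nonempty) : ∃ v : P.Vertex, v.1 ∈ G := by
  obtain ⟨x, hx⟩ := (isCompact_face hG).extremePoints_nonempty hne
  exact ⟨⟨x, isVertex_of_mem_extremePoints hG hx⟩, hx.1⟩

/-- A face is determined by its vertices. -/
theorem face_subset_iff {G K : Set (EuclideanSpace ℝ (Fin n))} (hG : G ∈ P.faces)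
    (hK : K ∈ P.faces) : G ⊆ K ↔ ∀ v : P.Vertex, v.1 ∈ G → v.1 ∈ K := by
  refine ⟨fun h v hv => h hv, fun h => ?_⟩
  -- Krein–Milman: a compact convex face is the closed hull of its extreme points, which are
  -- vertices.
  rw [← closure_convexHull_extremePoints (isCompact_face hG) (convex_face hG)]
  refine closure_minimal (convexHull_min (fun x hx => ?_) (convex_face hK))
    (isCompact_face hK).isClosed
  exact h ⟨x, isVertex_of_mem_extremePoints hG hx⟩ hx.1

variable (P) in
theorem combEquiv_vertices :
    CombEquiv P.faces (facesOf Set.univ fun i => {v : P.Vertex | i ∈ P.tight v.1}) := by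
  have hv : ∀ T : Set (Fin P.m), {v : P.Vertex | v.1 ∈ P.carrier ∩ ⋂ i ∈ T, P.facet i} =
      Set.univ ∩ ⋂ i ∈ T, {v : P.Vertex | i ∈ P.tight v.1} := by
    intro T
    ext v
    simp [mem_facet, mem_tight, v.2.mem_carrier]
  refine ⟨RelIso.ofSurjective (OrderEmbedding.ofMapLEIff (fun X : P.faces =>
    (⟨{v : P.Vertex | v.1 ∈ X.1}, ?_⟩ :
      facesOf Set.univ fun i => {v : P.Vertex | i ∈ P.tight v.1})) ?_) ?_⟩
  · obtain ⟨T, hT⟩ := X.2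
    exact ⟨T, by rw [hT, hv]⟩
  · intro X Y
    exact (face_subset_iff X.2 Y.2).symm
  · rintro ⟨Y, T, rfl⟩
    exact ⟨⟨_, T, rfl⟩, Subtype.ext (hv T)⟩

theorem pair_inter_mem_faces (i j : Fin P.m) : P.facet i ∩ P.facet j ∈ P.faces := by
  refine ⟨{i, j}, ?_⟩
  ext x
  simp only [mem_facet, Set.mem_inter_iff, Set.mem_iInter, Set.mem_insert_iff,
    Set.mem_singleton_iff, forall_eq_or_imp, forall_eq]
  tauto

theorem exists_vertex_of_isEdge {i j : Fin P.m} (h : P.IsEdge (P.facet i ∩ P.facet j)) :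
    ∃ v : P.Vertex, i ∈ P.tight v.1 ∧ j ∈ P.tight v.1 := by
  have hne : (P.facet i ∩ P.facet j).Nonempty := by
    rw [Set.nonempty_iff_ne_empty]
    intro he
    have := h.2
    rw [he, vectorSpan_empty, finrank_bot] at this
    exact zero_ne_one this
  obtain ⟨v, hv⟩ := exists_vertex_mem_face (pair_inter_mem_faces i j) hne
  exact ⟨v, mem_tight.2 hv.1.2, mem_tight.2 hv.2.2⟩

/-- With `c` the third facet at `v`, every point of the intersection lies on the line through `v`
along `P.dir v c`, and the neighbour of `v` on this line makes it nondegenerate. -/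
theorem isEdge_of_mem_tight {P : ConvexPolytope 3} (hs : P.IsSimple) {i j : Fin P.m} (hij : i ≠ j)
    {v : P.Vertex} (hi : i ∈ P.tight v.1) (hj : j ∈ P.tight v.1) :
    P.IsEdge (P.facet i ∩ P.facet j) := by
  refine ⟨pair_inter_mem_faces i j, ?_⟩
  obtain ⟨c, hc⟩ : ((P.tight v.1).erase i |>.erase j).Nonempty := by
    rw [← Finset.card_pos, Finset.card_erase_of_mem (Finset.mem_erase.2 ⟨hij.symm, hj⟩),
      Finset.card_erase_of_mem hi, hs.card_tight v.2]
    norm_num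
  simp only [Finset.mem_erase] at hc
  have heq : P.tight v.1 = {i, j, c} := by
    refine (Finset.eq_of_subset_of_card_le ?_ ?_).symm
    · intro x; simp only [Finset.mem_insert, Finset.mem_singleton]
      rintro (rfl | rfl | rfl) <;> tauto
    · rw [hs.card_tight v.2, Finset.card_eq_three.2 ⟨i, j, c, hij, hc.2.1.symm, hc.1.symm, rfl⟩]
  have hmem : ∀ x ∈ P.facet i ∩ P.facet j, x = v.1 + P.slack c x • P.dir v.1 c := by
    intro x hx
    refine hs.eq_add_smul_dir v.2 hc.2.2 fun k hk hkc => ?_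
    rw [heq] at hk
    simp only [Finset.mem_insert, Finset.mem_singleton] at hk
    rcases hk with rfl | rfl | rfl
    exacts [hx.1.2, hx.2.2, absurd rfl hkc]
  obtain ⟨t, ht, hvert, -, hsub⟩ := hs.exists_nbr v.2 hc.2.2
  have hspan : vectorSpan ℝ (P.facet i ∩ P.facet j) = Submodule.span ℝ {P.dir v.1 c} := by
    apply le_antisymm
    · rw [vectorSpan_def, Submodule.span_le]
      rintro _ ⟨x, hx, y, hy, rfl⟩
      refine Submodule.mem_span_singleton.2 ⟨P.slack c x - P.slack c y, ?_⟩
      dsimp only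
      rw [vsub_eq_sub]
      conv_rhs => rw [hmem x hx, hmem y hy]
      rw [sub_smul]; abel
    · rw [Submodule.span_singleton_le_iff_mem]
      have h1 : v.1 + t • P.dir v.1 c ∈ P.facet i ∩ P.facet j :=
        ⟨⟨hvert.mem_carrier, mem_tight.1 (hsub i hi hc.2.1.symm)⟩,
          ⟨hvert.mem_carrier, mem_tight.1 (hsub j hj hc.1.symm)⟩⟩
      have h2 : v.1 ∈ P.facet i ∩ P.facet j :=
        ⟨⟨v.2.mem_carrier, mem_tight.1 hi⟩, ⟨v.2.mem_carrier, mem_tight.1 hj⟩⟩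
      have h3 := vsub_mem_vectorSpan ℝ h1 h2
      rw [vsub_eq_sub, add_sub_cancel_left] at h3
      exact (Submodule.smul_mem_iff _ ht.ne').1 h3
  rw [hspan, finrank_span_singleton (hs.dir_ne_zero v.2 hc.2.2)]

end ConvexPolytope

/-! ### Recovering the incidences from the order on faces -/

/-- The facets `F i`, given by their sets of vertices, are the maximal proper faces, and the
vertices are the minimal nonempty faces. -/
structure IsIncidence {V Φ : Type*} (F : Φ → Set V) : Prop where
  exists_notMem : ∀ v, ∃ i, v ∉ F i
  eq_of_mem : ∀ v w, (∀ i, v ∈ F i → w ∈ F i) → w = v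
  eq_of_subset : ∀ i j, F i ⊆ F j → i = j
  ne_univ : ∀ i, F i ≠ Set.univ

namespace IsIncidence

variable {V Φ U Ψ : Type*} {F : Φ → Set V} {G : Ψ → Set U}

theorem singleton_mem (hF : IsIncidence F) (v : V) : {v} ∈ facesOf Set.univ F := by
  refine ⟨{i | v ∈ F i}, ?_⟩
  ext w
  simp only [Set.mem_singleton_iff, Set.univ_inter, Set.mem_iInter, Set.mem_ofPred_eq]
  exact ⟨fun h => h ▸ fun _ => id, hF.eq_of_mem v w⟩

theorem empty_mem (hF : IsIncidence F) : ∅ ∈ facesOf Set.univ F := by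
  refine ⟨Set.univ, ?_⟩
  ext w
  simpa using hF.exists_notMem w

theorem univ_mem (F : Φ → Set V) : Set.univ ∈ facesOf Set.univ F := ⟨∅, by simp⟩

theorem facet_mem (F : Φ → Set V) (i : Φ) : F i ∈ facesOf Set.univ F := ⟨{i}, by simp⟩

theorem exists_subset {X : Set V} (hX : X ∈ facesOf Set.univ F) (hne : X ≠ Set.univ) :
    ∃ i, X ⊆ F i := by
  obtain ⟨T, rfl⟩ := hX
  rcases T.eq_empty_or_nonempty with rfl | ⟨i, hi⟩
  · simp at hne
  · exact ⟨i, fun x hx => Set.mem_iInter₂.1 hx.2 i hi⟩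

variable (e : facesOf Set.univ F ≃o facesOf Set.univ G)

theorem map_nonempty (hF : IsIncidence F) (X : facesOf Set.univ F)
    (hX : X.1.Nonempty) : (e X).1.Nonempty := by
  rw [Set.nonempty_iff_ne_empty]
  intro he
  have h1 : e X ≤ e ⟨∅, hF.empty_mem⟩ := by
    change (e X).1 ⊆ _
    rw [he]; exact Set.empty_subset _
  have h2 : X.1 ⊆ ∅ := e.le_iff_le.1 h1
  exact hX.ne_empty (Set.subset_empty_iff.1 h2)

theorem map_ne_univ (X : facesOf Set.univ F) (hX : X.1 ≠ Set.univ) : (e X).1 ≠ Set.univ := by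
  intro he
  have h1 : e ⟨Set.univ, univ_mem F⟩ ≤ e X := by
    change _ ⊆ (e X).1
    rw [he]; exact Set.subset_univ _
  have h2 : Set.univ ⊆ X.1 := e.le_iff_le.1 h1
  exact hX (Set.univ_subset_iff.1 h2)

/-- Singletons are the minimal nonempty faces, a property that an order isomorphism and its inverse
preserve. -/
theorem map_singleton (hF : IsIncidence F) (hG : IsIncidence G) (v : V) :
    ∃ u, (e ⟨{v}, hF.singleton_mem v⟩).1 = {u} := by
  obtain ⟨u, hu⟩ := map_nonempty e hF ⟨{v}, hF.singleton_mem v⟩ (Set.singleton_nonempty v)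
  refine ⟨u, ?_⟩
  have h1 : (⟨{u}, hG.singleton_mem u⟩ : facesOf Set.univ G) ≤ e ⟨{v}, hF.singleton_mem v⟩ :=
    Set.singleton_subset_iff.2 hu
  have h2 : (e.symm ⟨{u}, hG.singleton_mem u⟩).1 ⊆ {v} := (e.symm_apply_le).2 h1
  have h3 := (Set.subset_singleton_iff_eq.1 h2).resolve_left
    (map_nonempty e.symm hG ⟨{u}, hG.singleton_mem u⟩ (Set.singleton_nonempty u)).ne_empty
  have h4 : e.symm ⟨{u}, hG.singleton_mem u⟩ = ⟨{v}, hF.singleton_mem v⟩ := Subtype.ext h3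
  rw [← h4, e.apply_symm_apply]

/-- Facets are the maximal proper faces: the image lies in some `G j`, whose preimage lies in some
`F i'`, and then `F i ⊆ F i'` forces equality. -/
theorem map_facet (hF : IsIncidence F) (hG : IsIncidence G) (i : Φ) :
    ∃ j, (e ⟨F i, facet_mem F i⟩).1 = G j := by
  obtain ⟨j, hj⟩ := exists_subset (e ⟨F i, facet_mem F i⟩).2
    (map_ne_univ e ⟨F i, facet_mem F i⟩ (hF.ne_univ i))
  obtain ⟨i', hi'⟩ := exists_subset (e.symm ⟨G j, facet_mem G j⟩).2
    (map_ne_univ e.symm ⟨G j, facet_mem G j⟩ (hG.ne_univ j))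
  have h1 : (⟨F i, facet_mem F i⟩ : facesOf Set.univ F) ≤ e.symm ⟨G j, facet_mem G j⟩ :=
    (e.le_symm_apply).2 hj
  obtain rfl := hF.eq_of_subset i i' (Set.Subset.trans h1 hi')
  have h2 : e.symm ⟨G j, facet_mem G j⟩ = ⟨F i, facet_mem F i⟩ := le_antisymm hi' h1
  exact ⟨j, by rw [← h2, e.apply_symm_apply]⟩

/-- A combinatorial equivalence comes from bijections of the vertices and of the facets. -/
theorem exists_of_combEquiv (hF : IsIncidence F) (hG : IsIncidence G)
    (h : CombEquiv (facesOf Set.univ F) (facesOf Set.univ G)) :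
    ∃ (g : Φ → Ψ) (f : V → U), Function.Injective g ∧ Function.Bijective f ∧
      ∀ v i, f v ∈ G (g i) ↔ v ∈ F i := by
  obtain ⟨e⟩ := h
  choose f hf using map_singleton e hF hG
  choose f' hf' using map_singleton e.symm hG hF
  choose g hg using map_facet e hF hG
  refine ⟨g, f, fun i j hij => ?_, ⟨fun v w hvw => ?_, fun u => ⟨f' u, ?_⟩⟩, fun v i => ?_⟩
  · have h1 : e ⟨F i, facet_mem F i⟩ = e ⟨F j, facet_mem F j⟩ :=
      Subtype.ext (by rw [hg, hg, hij])
    exact hF.eq_of_subset i j (congrArg Subtype.val (e.injective h1)).subset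
  · have h1 : e ⟨{v}, hF.singleton_mem v⟩ = e ⟨{w}, hF.singleton_mem w⟩ :=
      Subtype.ext (by rw [hf, hf, hvw])
    exact Set.singleton_injective (congrArg Subtype.val (e.injective h1))
  · have h1 : e.symm ⟨{u}, hG.singleton_mem u⟩ = ⟨{f' u}, hF.singleton_mem _⟩ :=
      Subtype.ext (hf' u)
    have h2 := hf (f' u)
    rw [← h1, e.apply_symm_apply] at h2
    exact (Set.singleton_injective h2).symm
  · rw [← Set.singleton_subset_iff, ← Set.singleton_subset_iff, ← hf, ← hg]
    exact e.le_iff_le (x := ⟨{v}, hF.singleton_mem v⟩) (y := ⟨F i, facet_mem F i⟩)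

end IsIncidence

theorem CubicSphere.isIncidence {V Φ : Type*} [Fintype V] [Fintype Φ] [DecidableEq Φ]
    (S : CubicSphere V Φ) (hF : ∀ i, ∃ v, i ∈ S.N v) :
    IsIncidence fun i => {v | i ∈ S.N v} where
  exists_notMem v := by
    by_contra! h
    simp only [Set.mem_ofPred_eq] at h
    obtain ⟨a, ha⟩ : (S.N v).Nonempty := by rw [← Finset.card_pos, S.card_N]; norm_num
    obtain ⟨w, haw, -⟩ := S.exists_nbr v a ha
    have := Finset.eq_of_subset_of_card_le (fun i _ => h i : S.N w ⊆ S.N v)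
      (by rw [S.card_N, S.card_N])
    exact haw (this ▸ ha)
  eq_of_mem v w h := S.N_injective (Finset.eq_of_subset_of_card_le (fun i hi => h i hi)
    (by rw [S.card_N, S.card_N])).symm
  eq_of_subset i j h := by
    by_contra hij
    obtain ⟨v, hv⟩ := hF i
    obtain ⟨w, hw, hb⟩ := S.exists_nbr v j (h hv)
    exact hw (h (hb i hv hij))
  ne_univ i h := by
    obtain ⟨v, hv⟩ := hF i
    obtain ⟨w, hw, -⟩ := S.exists_nbr v i hv
    have : w ∈ ({v | i ∈ S.N v} : Set V) := by rw [h]; trivial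
    exact hw this

/-! ### Incidences in `D k` -/

theorem DVertex.eq_of_facets_subset {k : ℕ} (u v : DVertex k) (h : u.facets ⊆ v.facets) :
    v = u := by
  have z1 : ∀ i i' : ZMod 5, (i = i' ∨ i = i' + 1) → (i + 1 = i' ∨ i + 1 = i' + 1) → i' = i := by
    decide
  have z0 : ∀ i : ZMod 5, i + 1 ≠ i := by decide
  rcases u with i | ⟨j, i⟩ | ⟨j, i⟩ | i <;> rcases v with i' | ⟨j', i'⟩ | ⟨j', i'⟩ | i' <;>
    simp only [DVertex.facets, Set.insert_subset_iff, Set.singleton_subset_iff,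
      Set.mem_insert_iff, Set.mem_singleton_iff, DFacet.ring.injEq, reduceCtorEq, false_or, or_false, false_and, and_false, true_and,
      Fin.ext_iff, Fin.val_castSucc, Fin.val_succ, Fin.val_last, Fin.val_zero] at h
  · rw [z1 i i' h.1 h.2]
  · have hj : (j : ℕ) = j' := by grind
    obtain rfl := Fin.ext hj
    rw [z1 i i' (by grind) (by grind)]
  · have hj : (j : ℕ) = j' := by grind
    exact absurd (show i + 1 = i by grind) (z0 i)
  · have := j.2; grind
  · have hj : (j : ℕ) = j' := by grind
    exact absurd (show i + 1 = i by grind) (z0 i)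
  · have hj : (j : ℕ) = j' := by grind
    obtain rfl := Fin.ext hj
    rw [z1 i i' (by grind) (by grind)]
  · have := j.2; grind
  · rw [z1 i i' h.1 h.2.1]

theorem isIncidence_dFacet (k : ℕ) : IsIncidence (DFacet.vertices (k := k)) where
  exists_notMem v := by
    rcases v with i | ⟨j, i⟩ | ⟨j, i⟩ | i
    · exact ⟨.bottom, by simp [DFacet.vertices, DVertex.facets]⟩
    all_goals exact ⟨.top, by simp [DFacet.vertices, DVertex.facets]⟩
  eq_of_mem v w h := DVertex.eq_of_facets_subset v w h
  eq_of_subset A B h := by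
    -- A facet is determined by two of its vertices that share no other facet; such a pair is
    -- exhibited for each kind of facet.
    have key : ∀ u v : DVertex k, A ∈ u.facets → A ∈ v.facets →
        (∀ B, B ∈ u.facets → B ∈ v.facets → B = A) → A = B :=
      fun u v hu hv hB => (hB B (h hu) (h hv)).symm
    have z1 : ∀ i : ZMod 5, i - 1 ≠ i := by decide
    have z2 : ∀ i : ZMod 5, i - 1 ≠ i + 1 := by decide
    rcases A with _ | ⟨j, i⟩ | _
    · refine key (.top 0) (.top 2) (by simp [DVertex.facets]) (by simp [DVertex.facets]) ?_
      intro B hB hB'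
      simp only [DVertex.facets, Set.mem_insert_iff, Set.mem_singleton_iff] at hB hB'
      rcases hB with rfl | rfl | rfl
      · rfl
      all_goals
        simp only [DFacet.ring.injEq, reduceCtorEq, false_or, true_and] at hB'
        exact absurd hB' (by decide)
    · induction j using Fin.cases with
      | zero =>
        refine key (.top (i - 1)) (.zig 0 i) (by simp [DVertex.facets])
          (by simp [DVertex.facets]) ?_
        intro B hB hB'
        simp only [DVertex.facets, Set.mem_insert_iff, Set.mem_singleton_iff] at hB hB'
        rcases hB with rfl | rfl | rfl
        · simp at hB'
        · simp [z1, z2] at hB'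
        · simp
      | succ j =>
        refine key (.zag j (i - 1)) (.zag j i) (by simp [DVertex.facets])
          (by simp [DVertex.facets]) ?_
        intro B hB hB'
        simp only [DVertex.facets, Set.mem_insert_iff, Set.mem_singleton_iff] at hB hB'
        rcases hB with rfl | rfl | rfl
        · simp only [DFacet.ring.injEq, Fin.ext_iff, Fin.val_castSucc, Fin.val_succ] at hB'
          grind
        · simp [z1, z2, Fin.ext_iff] at hB'
        · simp
    · refine key (.bottom 0) (.bottom 2) (by simp [DVertex.facets]) (by simp [DVertex.facets]) ?_
      intro B hB hB'
      simp only [DVertex.facets, Set.mem_insert_iff, Set.mem_singleton_iff] at hB hB'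
      rcases hB with rfl | rfl | rfl
      · simp only [DFacet.ring.injEq, reduceCtorEq, or_false, true_and] at hB'
        exact absurd hB' (by decide)
      · simp only [DFacet.ring.injEq, reduceCtorEq, or_false, true_and] at hB'
        exact absurd hB' (by decide)
      · rfl
  ne_univ A h := by
    have key : ∀ u : DVertex k, A ∈ u.facets := fun u => by
      have : u ∈ A.vertices := h ▸ Set.mem_univ u
      exact this
    have h1 := key (.top 0)
    have h2 := key (.top 2)
    have h3 := key (.bottom 0)
    simp only [DVertex.facets, Set.mem_insert_iff, Set.mem_singleton_iff] at h1 h2 h3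
    rcases h1 with rfl | rfl | rfl
    · simp at h3
    all_goals
      simp only [DFacet.ring.injEq, reduceCtorEq, false_or, true_and] at h2
      exact absurd h2 (by decide)

theorem CubicSphere.deg_eq_of_incidence {V Φ : Type*} [Fintype V] [Fintype Φ] [DecidableEq Φ]
    {S : CubicSphere V Φ} {k : ℕ} {g : DFacet k → Φ} {f : DVertex k → V} (hf : Function.Bijective f)
    (hi : ∀ u A, g A ∈ S.N (f u) ↔ A ∈ u.facets) {A : DFacet k} {s : ℕ} (c : Fin s → DVertex k)
    (hc : Function.Injective c) (hA : ∀ u, A ∈ u.facets ↔ ∃ t, c t = u) : S.deg (g A) = s := by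
  classical
  have : Finset.univ.filter (fun v => g A ∈ S.N v) = Finset.univ.image (f ∘ c) := by
    ext v
    obtain ⟨u, rfl⟩ := hf.2 v
    simp [hi, hA, hf.1.eq_iff]
  rw [deg, this, Finset.card_image_of_injective _ (hf.1.comp hc),
    Finset.card_univ, Fintype.card_fin]

theorem DVertex.top_mem_facets {k : ℕ} (u : DVertex k) :
    DFacet.top ∈ u.facets ↔ ∃ t : Fin 5, DVertex.top (k := k) (t : ZMod 5) = u := by
  rcases u with i | ⟨j, i⟩ | ⟨j, i⟩ | i <;> simp [DVertex.facets]
  exact ⟨i, rfl⟩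

theorem DVertex.ring_zero_mem_facets {k : ℕ} (i : ZMod 5) (u : DVertex k) :
    DFacet.ring 0 i ∈ u.facets ↔
      ∃ t, ![.top i, .top (i - 1), .zig 0 i, .zig 0 (i - 1), .zag 0 (i - 1)] t = u := by
  have hex : (∃ t, ![DVertex.top (k := k) i, .top (i - 1), .zig 0 i, .zig 0 (i - 1),
      .zag 0 (i - 1)] t = u) ↔ .top i = u ∨ .top (i - 1) = u ∨ .zig 0 i = u ∨
      .zig 0 (i - 1) = u ∨ .zag 0 (i - 1) = u := by
    simp only [Fin.exists_fin_succ]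
    simp
  rw [hex]
  have z : ∀ i i' : ZMod 5, i = i' + 1 ↔ i - 1 = i' := by decide
  rcases u with i' | ⟨j, i'⟩ | ⟨j, i'⟩ | i'
  · simp [DVertex.facets, z]
  · induction j using Fin.cases with
    | zero => simp [DVertex.facets, z]
    | succ j => simp [DVertex.facets, Fin.ext_iff]
  · induction j using Fin.cases with
    | zero => simp [DVertex.facets, z]
    | succ j => simp [DVertex.facets, Fin.ext_iff]
  · simp [DVertex.facets, Fin.ext_iff]

/-! ### The two implications -/

namespace ConvexPolytope

variable {P : ConvexPolytope 3}

/-- Five different neighbours of the pentagon `c` are all its neighbours, so every facet around `c`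
is a pentagon and `exists_ring_cover` applies. -/
theorem exists_combEquiv_of_containsCap {hs : P.IsSimple}
    {hF : ∀ i, ∃ v : P.Vertex, i ∈ P.tight v.1} {h0 : 0 < P.m}
    (hd : (P.toCubicSphere hs hF h0).FiveSix) (h : P.ContainsCap) :
    ∃ k : ℕ, CombEquiv P.faces (DFaces k) := by
  obtain ⟨c, p, hc, hp, hinj, hpc, hcp, -⟩ := h
  set S := P.toCubicSphere hs hF h0 with hS
  have hc' : S.deg c = 5 := isGon_iff.1 hc
  obtain ⟨q, -, -, hq⟩ := CubicSphere.exists_link_five hc'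
  have hpq : ∀ i, ∃ j, p i = q j := fun i => by
    obtain ⟨v, h1, h2⟩ := exists_vertex_of_isEdge (hcp i)
    exact hq v (p i) h1 h2 (hpc i)
  choose r hr using hpq
  have hrinj : Function.Injective r := fun i j hij => hinj (by rw [hr, hr, hij])
  have hrsurj := Finite.surjective_of_injective hrinj
  obtain ⟨k, g, f, hg, hf, hi⟩ := CubicSphere.exists_ring_cover hd hc' fun v b h1 h2 hbc => by
    obtain ⟨j, rfl⟩ := hq v b h1 h2 hbc
    obtain ⟨i, rfl⟩ := hrsurj j
    rw [← hr]
    exact isGon_iff.1 (hp i)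
  obtain ⟨e₁⟩ := P.combEquiv_vertices
  obtain ⟨e₂⟩ := combEquiv_of_incidence (F := fun i => {v : P.Vertex | i ∈ P.tight v.1})
    (G := DFacet.vertices (k := k)) g f hg hf hi
  exact ⟨k, ⟨e₁.trans e₂⟩⟩

/-- The facet `.top` and ring `0` of `D k` form a cap; vertex counts and adjacencies pass to `P`
through the incidences recovered from the equivalence. -/
theorem containsCap_of_combEquiv (hs : P.IsSimple)
    (hF : ∀ i, ∃ v : P.Vertex, i ∈ P.tight v.1) (h0 : 0 < P.m) {k : ℕ}
    (h : CombEquiv P.faces (DFaces k)) : P.ContainsCap := by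
  obtain ⟨e⟩ := h
  obtain ⟨e₁⟩ := P.combEquiv_vertices
  obtain ⟨g, f, hg, hf, hi⟩ := (isIncidence_dFacet k).exists_of_combEquiv
    ((P.toCubicSphere hs hF h0).isIncidence hF) ⟨e.symm.trans e₁⟩
  have hi' : ∀ u A, g A ∈ P.tight (f u).1 ↔ A ∈ u.facets := hi
  refine ⟨g .top, fun i => g (.ring 0 i), ?_, fun i => ?_, fun i j hij => ?_, fun i hij => ?_,
    fun i => ?_, fun i => ?_⟩
  · exact (isGon_iff (hs := hs) (hF := hF) (h0 := h0)).2 (CubicSphere.deg_eq_of_incidence hf hi'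
      _ (fun i j hij => DVertex.top.inj hij) DVertex.top_mem_facets)
  · refine (isGon_iff (hs := hs) (hF := hF) (h0 := h0)).2 (CubicSphere.deg_eq_of_incidence hf hi'
      _ ?_ (DVertex.ring_zero_mem_facets i))
    have z1 : i - 1 ≠ i := by revert i; decide
    intro s t hst
    fin_cases s <;> fin_cases t <;> simp [z1, z1.symm] at hst ⊢
  · simpa using hg hij
  · simpa using hg hij
  · exact isEdge_of_mem_tight hs (fun h => by simpa using hg h) (v := f (.top i))
      ((hi' _ _).2 (by simp [DVertex.facets])) ((hi' _ _).2 (by simp [DVertex.facets]))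
  · have z : i ≠ i + 1 := by revert i; decide
    exact isEdge_of_mem_tight hs (fun h => by simpa [-left_eq_add, z] using hg h) (v := f (.top i))
      ((hi' _ _).2 (by simp [DVertex.facets])) ((hi' _ _).2 (by simp [DVertex.facets]))

end ConvexPolytope

theorem mainTheorem6 (P : ConvexPolytope 3) (hP : P.IsFullerene) :
    (∃ k : ℕ, CombEquiv P.faces (DFaces k)) ↔ P.ContainsCap := by
  obtain ⟨hs, hgon⟩ := hP
  have h0 : 0 < P.m := by
    obtain ⟨x, hx⟩ := P.fullDim
    -- Boundedness needs an inequality that bounds the first coordinate direction, so there is at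
    -- least one.
    obtain ⟨j, -⟩ := ConvexPolytope.exists_inner_neg (P := P) (interior_subset hx)
      (d := EuclideanSpace.single 0 1) (by simp)
    exact j.pos
  have hF : ∀ i, ∃ v : P.Vertex, i ∈ P.tight v.1 := by
    intro i
    have hne : {v | P.IsVertex v ∧ v ∈ P.facet i}.ncard ≠ 0 := by
      rcases hgon i with h | h <;> rw [ConvexPolytope.IsGon] at h <;> omega
    obtain ⟨v, hv, hvi⟩ := Set.nonempty_of_ncard_ne_zero hne
    exact ⟨⟨v, hv⟩, ConvexPolytope.mem_tight.2 hvi.2⟩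
  have hd : (P.toCubicSphere hs hF h0).FiveSix := fun i =>
    (hgon i).imp ConvexPolytope.isGon_iff.1 ConvexPolytope.isGon_iff.1
  exact ⟨fun ⟨_, h⟩ => ConvexPolytope.containsCap_of_combEquiv hs hF h0 h,
    ConvexPolytope.exists_combEquiv_of_containsCap hd⟩
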